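/- **Theorem 1.4.** Let $(V(u),\,u\in\mathbb T)$ be a branching random walk on $\mathbb R$ started from one particle $\varnothing$ at $0$: the positions of the children of the root form a point process $\aleph$ on $\mathbb R$, and recursively each particle $u$ gives birth to children whose positions form an independent copy of $\aleph$ shifted by $V(u)$; $\mathbb T$ is the Ulam–Harris tree of all particles. Let $\mu(\mathrm dx):=\mathbf E[\aleph(\mathrm dx)]$, assume that $\mu(\mathbb R)>1$, and put $\varphi(t):=\log\int_{\mathbb R}e^{-tx}\mu(\mathrm dx)\in[-\infty,\infty]$. Let $\mathbf P^*$ be the law conditioned on the non-extinction of $\mathbb T$. A ray $\xi$ of $\mathbb T$ is either the path $\varnothing=\xi_0,\xi_1,\dots$ from the root to a leaf of $\mathbb T$, or an infinite path $\varnothing=\xi_0,\xi_1,\xi_2,\dots$ in which $\xi_n$ is the parent of $\xi_{n+1}$ for all $n\ge 0$; $\partial\mathbb T$ is the set of all (finite or infinite) rays. For $\xi\in\partial\mathbb T$ and $k\in\mathbb Z$ let $$N_\xi^k:=\sum_{n\ge 0}\mathbf 1_{\{k\le V(\xi_n)<k+1\}}\in\{0,1,2,\dots,\infty\},$$ where the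 sum is over the generations $n$ present on $\xi$. We say that $\int_{\mathbb R} xe^{-tx}\mu(\mathrm dx)$ is well-defined if at least one of $\int_{(-\infty,0)}|x|e^{-tx}\mu(\mathrm dx)$ and $\int_{(0,\infty)}xe^{-tx}\mu(\mathrm dx)$ is finite. Consider the following assumptions. **(H1)** There exists $t>0$ with $\varphi(t)=0$; with $t^*$ the minimal such $t$, the integral $\int_{\mathbb R}xe^{-t^*x}\mu(\mathrm dx)$ is well-defined and nonzero (possibly infinite). **(H2)** There exists $t^*>0$ with $\varphi(t^*)=0$, and $\varphi(t)\in[0,\infty]$ for all $t>0$; the integral $\int_{\mathbb R}xe^{-t^*x}\mu(\mathrm dx)$ is well-defined and equal to $0$, and $\int_{\mathbb R}x^2e^{-t^*x}\mu(\mathrm dx)\in(0,\infty)$. Then, under (H1), $\mathbf P^*$-almost surely, for all $\kappa>1$, $$\lim_{n\to\infty}\frac1{n^\kappa}\sup_{\xi\in\partial\mathbb T}N_\xi^n=0;$$ and under (H2), $\mathbf P^*$-almost surely, the same limit holds for all $\kappa>2$. -/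

import Mathlib

open MeasureTheory ProbabilityTheory Filter Topology
open scoped ENNReal

/-- Vertices of the Ulam-Harris tree: finite words of natural numbers. A word is listed from its
last letter to its first, so `[]` is the root, `i :: u` is the `i`-th child of `u`, the generation
of `u` is `u.length`, and the ancestors of `u` (including `u`) are the suffixes of `u`. -/
abbrev Vertex : Type := List ℕ

/-- A branching random walk on the real line, started from one particle at `0`. Every potential
vertex `u` carries a reproduction: a number of children in `{0, 1, 2, …, ∞}` and the displacements
of the children relative to `u`. The reproductions are independent and identically distributed. -/
structure BranchingRandomWalk {Ω : Type*} [MeasurableSpace Ω] (P : Measure Ω) where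
  /-- The number of children of `u`; the children are `i :: u` with `i < numChildren u`. -/
  numChildren : Vertex → Ω → ℕ∞
  /-- The displacement of the child `i :: u` from `u` (only used for `i < numChildren u`). -/
  displacement : Vertex → Ω → ℕ → ℝ
  measurable_numChildren : ∀ u, Measurable (numChildren u)
  measurable_displacement : ∀ u, Measurable (displacement u)
  independent : iIndepFun (fun u ω => (numChildren u ω, displacement u ω)) P
  identDistrib : ∀ u, IdentDistrib (fun ω => (numChildren u ω, displacement u ω))
    (fun ω => (numChildren [] ω, displacement [] ω)) P P

/-- `IsRay T ξ`: the set of vertices `ξ` is a ray of the tree `T`, that is, either the path from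
the root to a leaf of `T`, or an infinite path in `T` that starts at the root and goes from
parent to child. -/
def IsRay (T : Set Vertex) (ξ : Set Vertex) : Prop :=
  (∃ u ∈ T, (∀ i : ℕ, i :: u ∉ T) ∧ ξ = {w | w <:+ u}) ∨
  (∃ x : ℕ → Vertex, x 0 = [] ∧ (∀ n, x n ∈ T) ∧ (∀ n, ∃ i : ℕ, x (n + 1) = i :: x n) ∧
    ξ = Set.range x)

namespace BranchingRandomWalk

variable {Ω : Type*} [MeasurableSpace Ω] {P : Measure Ω}

/-- `u` belongs to the genealogical tree. -/
def Alive (B : BranchingRandomWalk P) (ω : Ω) : Vertex → Prop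
  | [] => True
  | i :: u => B.Alive ω u ∧ (i : ℕ∞) < B.numChildren u ω

/-- The genealogical tree. -/
def tree (B : BranchingRandomWalk P) (ω : Ω) : Set Vertex := {u | B.Alive ω u}

/-- The position `V(u)` of the particle `u`. -/
noncomputable def V (B : BranchingRandomWalk P) (ω : Ω) : Vertex → ℝ
  | [] => 0
  | i :: u => B.V ω u + B.displacement u ω i

/-- The point process formed by the positions of the particles of the first generation. -/
noncomputable def aleph (B : BranchingRandomWalk P) (ω : Ω) : Measure ℝ :=
  Measure.sum fun i : {i : ℕ // [i] ∈ B.tree ω} => Measure.dirac (B.V ω [i.1])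

/-- The intensity measure: the expectation of the point process `aleph`, see `mu_apply`. -/
noncomputable def mu (B : BranchingRandomWalk P) : Measure ℝ := P.bind B.aleph

theorem measurable_aleph (B : BranchingRandomWalk P) : Measurable B.aleph := by
  classical
  refine Measure.measurable_of_measurable_coe _ fun s hs => ?_
  have key : (fun ω => B.aleph ω s) = fun ω => ∑' i : ℕ,
      ({ω | (i : ℕ∞) < B.numChildren [] ω} ∩ {ω | B.displacement [] ω i ∈ s}).indicator
        (fun _ => (1 : ℝ≥0∞)) ω := by
    funext ω
    rw [aleph, Measure.sum_apply _ hs]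
    refine (tsum_subtype {i : ℕ | [i] ∈ B.tree ω}
      (fun i => Measure.dirac (B.V ω [i]) s)).trans (tsum_congr fun i => ?_)
    simp only [Set.indicator, Measure.dirac_apply' _ hs, tree, Alive, V, Set.mem_ofPred_eq,
      true_and, zero_add, Set.mem_inter_iff, Pi.one_apply]
    split_ifs <;> simp_all
  rw [key]
  refine Measurable.tsum fun i => measurable_const.indicator ?_
  refine MeasurableSet.inter ?_ ?_
  · exact (B.measurable_numChildren []) (MeasurableSet.of_discrete (s := {k | (i : ℕ∞) < k}))
  · exact ((measurable_pi_apply i).comp (B.measurable_displacement [])) hs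

theorem mu_apply (B : BranchingRandomWalk P) {s : Set ℝ} (hs : MeasurableSet s) :
    B.mu s = ∫⁻ ω, B.aleph ω s ∂P :=
  Measure.bind_apply hs B.measurable_aleph.aemeasurable

/-- The event of non-extinction: there are particles in every generation. -/
def nonExtinction (B : BranchingRandomWalk P) : Set Ω :=
  {ω | ∀ n : ℕ, ∃ u ∈ B.tree ω, u.length = n}

/-- The law conditioned on non-extinction. -/
noncomputable def Pstar (B : BranchingRandomWalk P) : Measure Ω := P[|B.nonExtinction]

/-- The local time at `k` along `ξ`: the number of particles `u` on `ξ` with `k ≤ V(u) < k + 1`.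
A ray has at most one vertex in each generation, so on a ray this is the number of times `n` at
which the path `V(ξ_0), V(ξ_1), …` is in `[k, k + 1)`. -/
noncomputable def localTime (B : BranchingRandomWalk P) (ω : Ω) (ξ : Set Vertex) (k : ℤ) : ℕ∞ :=
  {u ∈ ξ | (k : ℝ) ≤ B.V ω u ∧ B.V ω u < k + 1}.encard

/-- The supremum of the local times at `k` over all rays, in `[0, ∞]`. -/
noncomputable def supLocalTime (B : BranchingRandomWalk P) (ω : Ω) (k : ℤ) : ℝ≥0∞ :=
  ⨆ (ξ : Set Vertex) (_ : IsRay (B.tree ω) ξ), (B.localTime ω ξ k : ℝ≥0∞)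

end BranchingRandomWalk

/-- The log-Laplace transform `log ∫ e^{-tx} μ(dx)`, with values in `[-∞, ∞]`. -/
noncomputable def logLaplace (μ : Measure ℝ) (t : ℝ) : EReal :=
  ENNReal.log (∫⁻ x, ENNReal.ofReal (Real.exp (-t * x)) ∂μ)

/-- `∫_{(0,∞)} x e^{-tx} μ(dx)` -/
noncomputable def posMoment (μ : Measure ℝ) (t : ℝ) : ℝ≥0∞ :=
  ∫⁻ x in Set.Ioi 0, ENNReal.ofReal (x * Real.exp (-t * x)) ∂μ

/-- `∫_{(-∞,0)} |x| e^{-tx} μ(dx)` -/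
noncomputable def negMoment (μ : Measure ℝ) (t : ℝ) : ℝ≥0∞ :=
  ∫⁻ x in Set.Iio 0, ENNReal.ofReal (|x| * Real.exp (-t * x)) ∂μ

/-- The integral `∫ x e^{-tx} μ(dx)` is well-defined in `[-∞, ∞]`. -/
def MomentWellDefined (μ : Measure ℝ) (t : ℝ) : Prop := posMoment μ t ≠ ∞ ∨ negMoment μ t ≠ ∞

/-- The integral `∫ x e^{-tx} μ(dx)` in `[-∞, ∞]` (meaningful if `MomentWellDefined μ t`). -/
noncomputable def moment1 (μ : Measure ℝ) (t : ℝ) : EReal :=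
  (posMoment μ t : EReal) - (negMoment μ t : EReal)

/-- Assumption (H1): `φ = logLaplace μ` has a positive zero; at the least one, `tstar`, the integral
`∫ x e^{-tstar x} μ(dx)` is well-defined and nonzero (possibly infinite). -/
def H1 (μ : Measure ℝ) : Prop :=
  ∃ tstar : ℝ, IsLeast {t : ℝ | 0 < t ∧ logLaplace μ t = 0} tstar ∧
    MomentWellDefined μ tstar ∧ moment1 μ tstar ≠ 0

/-- Assumption (H2): `φ = logLaplace μ` has a positive zero `tstar` and is nonnegative on `(0, ∞)`; the
integral `∫ x e^{-tstar x} μ(dx)` is well-defined and zero, and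
`∫ x ^ 2 e^{-tstar x} μ(dx)` is in `(0, ∞)`. -/
def H2 (μ : Measure ℝ) : Prop :=
  ∃ tstar : ℝ, 0 < tstar ∧ logLaplace μ tstar = 0 ∧ (∀ t : ℝ, 0 < t → 0 ≤ logLaplace μ t) ∧
    MomentWellDefined μ tstar ∧ moment1 μ tstar = 0 ∧
    0 < ∫⁻ x, ENNReal.ofReal (x ^ 2 * Real.exp (-tstar * x)) ∂μ ∧
    ∫⁻ x, ENNReal.ofReal (x ^ 2 * Real.exp (-tstar * x)) ∂μ < ∞

/-! At a zero `t` of the log-Laplace transform the tilted measure `ν = expTilt B.mu t` is a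
probability measure. The many-to-one formula then turns the expectation of a sum over particles,
weighted by `e^{-t V(u)}`, into an expectation for the random walk with step law `ν`.

Two first moment bounds follow. Some particle goes below `-n` with probability at most `e^{-tn}`
(`mul_measure_exists_lt_le`), so the walk may be killed there. If the killed walk has Green function
at most `G` on `[n, n + 1)`, then rewarding each visit by a factor `1 + 1/(2G)` keeps expectations
bounded by `1 + 2G`. Hence a local time above `m` has probability at most `e^{t(n+1)} (1 + 2G) (1 +
1/(2G))^{-m}` on the event that nobody goes below `-n` (`mul_measure_lt_supLocalTime_le`). With `G =
C n^j` and `m = A n^{j+1}` this is summable, and Borel–Cantelli gives local times `O(n^{j+1})`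
(`ae_eventually_supLocalTime_le`).

It remains to bound the Green function, by the maximum principle `partialGreen_le`. Under (H1) the
walk has a nonzero, possibly infinite, mean; it is transient and `j = 0`
(`exists_partialGreen_le_of_drift`). Under (H2) it is centered with finite variance: it makes `O(n)`
visits before time `n ^ 2`, by which time it has been killed with probability bounded below, so `j =
1` (`exists_eventually_partialGreen_le`). -/

/-- The exponential tilt `e^{-tx} μ(dx)`. -/
noncomputable def expTilt (μ : Measure ℝ) (t : ℝ) : Measure ℝ :=
  μ.withDensity fun x => ENNReal.ofReal (Real.exp (-t * x))

/-! ### Superharmonic functions on the tree. -/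

theorem tsum_vertex (b : Vertex → ℝ≥0∞) :
    ∑' u, b u = b [] + ∑' (u : Vertex) (i : ℕ), b (i :: u) := by
  let e : Unit ⊕ (Vertex × ℕ) ≃ Vertex :=
    { toFun := Sum.elim (fun _ => []) fun p => p.2 :: p.1
      invFun := fun u => u.casesOn (Sum.inl ()) fun i v => Sum.inr (v, i)
      left_inv := by rintro (_ | ⟨u, i⟩) <;> rfl
      right_inv := by rintro (_ | ⟨i, u⟩) <;> rfl }
  rw [← e.tsum_eq b, ENNReal.summable.tsum_sum ENNReal.summable, tsum_fintype, ENNReal.tsum_prod']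
  simp [e]

/-- A superharmonic function on the Ulam-Harris tree dominates the total mass of its defect. -/
theorem tsum_le_root_of_superharmonic {a b : Vertex → ℝ≥0∞}
    (h : ∀ u, a u + ∑' i : ℕ, b (i :: u) ≤ b u) : ∑' u, a u ≤ b [] := by
  -- The mass of `b` on generation `n` pays for `a` there and for `b` on generation `n + 1`.
  have key : ∀ n : ℕ, ∑' u : Vertex, (if u.length < n then a u else 0) +
      ∑' u : Vertex, (if u.length = n then b u else 0) ≤ b [] := by
    intro n
    induction n with
    | zero =>
      rw [tsum_vertex (fun u => if u.length = 0 then b u else 0)]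
      simp
    | succ n ih =>
      refine le_trans ?_ ih
      rw [tsum_vertex (fun u => if u.length = n + 1 then b u else 0)]
      simp only [List.length_nil, List.length_cons, Nat.add_right_cancel_iff]
      rw [if_neg (by omega), zero_add, ← ENNReal.tsum_add, ← ENNReal.tsum_add]
      refine ENNReal.tsum_le_tsum fun u => ?_
      rcases lt_trichotomy u.length n with hu | hu | hu
      · simp [hu, hu.ne, Nat.lt_succ_of_lt hu]
      · simpa [hu] using h u
      · simp [hu.ne', not_lt.2 hu.le, show ¬ u.length < n + 1 by omega]
  rw [ENNReal.tsum_eq_iSup_sum]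
  refine iSup_le fun s => ?_
  obtain ⟨n, hn⟩ : ∃ n : ℕ, ∀ u ∈ s, u.length < n :=
    ⟨s.sup List.length + 1, fun u hu => Nat.lt_succ_of_le (Finset.le_sup (f := List.length) hu)⟩
  calc ∑ u ∈ s, a u = ∑ u ∈ s, (if u.length < n then a u else 0) :=
        Finset.sum_congr rfl fun u hu => by rw [if_pos (hn u hu)]
    _ ≤ ∑' u : Vertex, (if u.length < n then a u else 0) := ENNReal.sum_le_tsum s
    _ ≤ b [] := le_trans le_self_add (key n)

/-! ### The many-to-one formula and first moment bounds. -/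

namespace BranchingRandomWalk

variable {Ω : Type*} [MeasurableSpace Ω] {P : Measure Ω}

/-- The reproduction of `u`: the number of its children and their displacements. -/
def reproduction (B : BranchingRandomWalk P) (u : Vertex) (ω : Ω) : ℕ∞ × (ℕ → ℝ) :=
  (B.numChildren u ω, B.displacement u ω)

theorem measurable_reproduction (B : BranchingRandomWalk P) (u : Vertex) :
    Measurable (B.reproduction u) :=
  (B.measurable_numChildren u).prodMk (B.measurable_displacement u)

/-- The product of `w` over the positions of the strict ancestors of `u`. -/
noncomputable def weight (B : BranchingRandomWalk P) (w : ℝ → ℝ≥0∞) (ω : Ω) : Vertex → ℝ≥0∞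
  | [] => 1
  | _ :: u => B.weight w ω u * w (B.V ω u)

/-- The sigma-algebra generated by the reproductions of the strict ancestors of `u`. -/
abbrev past (B : BranchingRandomWalk P) (u : Vertex) : MeasurableSpace Ω :=
  ⨆ v ∈ {v : Vertex | v <:+ u ∧ v ≠ u}, MeasurableSpace.comap (B.reproduction v) inferInstance

theorem past_le (B : BranchingRandomWalk P) (u : Vertex) : B.past u ≤ ‹MeasurableSpace Ω› :=
  iSup₂_le fun v _ => (B.measurable_reproduction v).comap_le

theorem past_mono_cons (B : BranchingRandomWalk P) (i : ℕ) (u : Vertex) :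
    B.past u ≤ B.past (i :: u) := by
  refine biSup_mono fun v hv => ⟨hv.1.trans (List.suffix_cons i u), fun h => ?_⟩
  have := hv.1.length_le
  rw [h] at this
  simp at this

theorem comap_reproduction_le_past_cons (B : BranchingRandomWalk P) (i : ℕ) (u : Vertex) :
    MeasurableSpace.comap (B.reproduction u) inferInstance ≤ B.past (i :: u) :=
  le_iSup₂_of_le (f := fun v _ => MeasurableSpace.comap (B.reproduction v) inferInstance) u
    ⟨List.suffix_cons i u, (List.cons_ne_self i u).symm⟩ le_rfl

theorem measurable_past_reproduction (B : BranchingRandomWalk P) (i : ℕ) (u : Vertex) :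
    Measurable[B.past (i :: u)] (B.reproduction u) :=
  (comap_measurable _).mono (B.comap_reproduction_le_past_cons i u) le_rfl

theorem measurableSet_lt_fst {α : Type*} [MeasurableSpace α] (i : ℕ) :
    MeasurableSet {r : ℕ∞ × α | (i : ℕ∞) < r.1} :=
  measurable_fst (MeasurableSet.of_discrete (s := {k : ℕ∞ | (i : ℕ∞) < k}))

theorem measurableSet_past_alive (B : BranchingRandomWalk P) (u : Vertex) :
    MeasurableSet[B.past u] {ω | B.Alive ω u} := by
  induction u with
  | nil => simp [Alive]
  | cons i u ih =>
    exact MeasurableSet.inter (B.past_mono_cons i u _ ih)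
      (B.measurable_past_reproduction i u (measurableSet_lt_fst i))

theorem measurable_past_V (B : BranchingRandomWalk P) (u : Vertex) :
    Measurable[B.past u] (fun ω => B.V ω u) := by
  induction u with
  | nil => exact @measurable_const _ _ _ (_) _
  | cons i u ih =>
    exact Measurable.add (ih.mono (B.past_mono_cons i u) le_rfl)
      ((measurable_pi_apply i).comp
        (measurable_snd.comp (B.measurable_past_reproduction i u)))

theorem measurable_past_weight (B : BranchingRandomWalk P) {w : ℝ → ℝ≥0∞} (hw : Measurable w)
    (u : Vertex) : Measurable[B.past u] (fun ω => B.weight w ω u) := by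
  induction u with
  | nil => exact @measurable_const _ _ _ (_) _
  | cons i u ih =>
    exact Measurable.mul (ih.mono (B.past_mono_cons i u) le_rfl)
      (hw.comp ((B.measurable_past_V u).mono (B.past_mono_cons i u) le_rfl))

theorem indep_past_reproduction (B : BranchingRandomWalk P) (u : Vertex) :
    Indep (B.past u) (MeasurableSpace.comap (B.reproduction u) inferInstance) P := by
  have h := indep_iSup_of_disjoint (S := {v : Vertex | v <:+ u ∧ v ≠ u}) (T := {u})
    (fun v => (B.measurable_reproduction v).comap_le) ((iIndepFun_iff_iIndep _ _ _).1 B.independent)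
    (by simp)
  simpa [past] using h

theorem map_reproduction (B : BranchingRandomWalk P) (u : Vertex) :
    P.map (B.reproduction u) = P.map (B.reproduction []) :=
  (B.identDistrib u).map_eq

/-- Campbell's formula for the first generation. It is phrased through the law of the root's
reproduction because every vertex shares that law. -/
theorem lintegral_mu (B : BranchingRandomWalk P) {φ : ℝ → ℝ≥0∞} (hφ : Measurable φ) :
    ∫⁻ x, φ x ∂B.mu = ∫⁻ r, ∑' i : ℕ, (if (i : ℕ∞) < r.1 then φ (r.2 i) else 0)
      ∂(P.map (B.reproduction [])) := by
  rw [mu, Measure.lintegral_bind B.measurable_aleph.aemeasurable hφ.aemeasurable,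
    lintegral_map _ (B.measurable_reproduction [])]
  · refine lintegral_congr fun ω => ?_
    rw [aleph, lintegral_sum_measure]
    refine (tsum_subtype {i : ℕ | [i] ∈ B.tree ω}
      (fun i => ∫⁻ x, φ x ∂(Measure.dirac (B.V ω [i])))).trans (tsum_congr fun i => ?_)
    simp only [Set.indicator, lintegral_dirac' _ hφ, tree, Alive, V, reproduction,
      Set.mem_ofPred_eq, true_and, zero_add]
    congr
  · exact Measurable.tsum fun i => Measurable.ite (measurableSet_lt_fst i)
      (hφ.comp ((measurable_pi_apply i).comp measurable_snd)) measurable_const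

/-- The expectation of `e^{-t V(u)} W(u) φ(V(u))` on the event that `u` is alive, where `W(u)` is
the product of `w` over the positions of the strict ancestors of `u`. -/
noncomputable def tiltedMean (B : BranchingRandomWalk P) (t : ℝ) (w φ : ℝ → ℝ≥0∞) (u : Vertex) :
    ℝ≥0∞ :=
  ∫⁻ ω, {ω | B.Alive ω u}.indicator
    (fun ω => ENNReal.ofReal (Real.exp (-t * B.V ω u)) * B.weight w ω u * φ (B.V ω u)) ω ∂P

theorem measurable_tiltedMean_integrand (B : BranchingRandomWalk P) (t : ℝ) {w φ : ℝ → ℝ≥0∞}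
    (hw : Measurable w) (hφ : Measurable φ) (u : Vertex) :
    Measurable[B.past u] ({ω | B.Alive ω u}.indicator
    (fun ω => ENNReal.ofReal (Real.exp (-t * B.V ω u)) * B.weight w ω u * φ (B.V ω u))) := by
  refine Measurable.indicator ?_ (B.measurableSet_past_alive u)
  have hV := B.measurable_past_V u
  refine Measurable.mul (Measurable.mul ?_ (B.measurable_past_weight hw u)) (hφ.comp hV)
  exact (ENNReal.measurable_ofReal.comp (Real.measurable_exp.comp
    (measurable_const.mul measurable_id))).comp hV

/-- The one-step many-to-one formula. -/
theorem tsum_tiltedMean_children (B : BranchingRandomWalk P) [IsProbabilityMeasure P] (t : ℝ)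
    {w φ : ℝ → ℝ≥0∞} (hw : Measurable w) (hφ : Measurable φ) (u : Vertex) :
    ∑' i : ℕ, B.tiltedMean t w φ (i :: u) =
      B.tiltedMean t w (fun x => w x * ∫⁻ y, φ (x + y) ∂(expTilt B.mu t)) u := by
  set A : Ω → ℝ≥0∞ := {ω | B.Alive ω u}.indicator
    (fun ω => ENNReal.ofReal (Real.exp (-t * B.V ω u)) * B.weight w ω u * w (B.V ω u)) with hA
  have hAm : Measurable[B.past u] A := B.measurable_tiltedMean_integrand t hw hw u
  have hAV : Measurable[B.past u] (fun ω => (A ω, B.V ω u)) :=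
    hAm.prodMk (B.measurable_past_V u)
  -- Survival, position and weight of `u` depend only on its strict ancestors, so its own
  -- reproduction can be integrated out separately.
  have hind : IndepFun (fun ω => (A ω, B.V ω u)) (B.reproduction u) P := by
    rw [IndepFun_iff_Indep]
    exact indep_of_indep_of_le_left (B.indep_past_reproduction u) hAV.comap_le
  set H : (ℝ≥0∞ × ℝ) × (ℕ∞ × (ℕ → ℝ)) → ℝ≥0∞ := fun p => p.1.1 *
    ∑' i : ℕ, (if (i : ℕ∞) < p.2.1 then
      ENNReal.ofReal (Real.exp (-t * p.2.2 i)) * φ (p.1.2 + p.2.2 i) else 0) with hH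
  have hcoord : ∀ i : ℕ, Measurable fun p : (ℝ≥0∞ × ℝ) × (ℕ∞ × (ℕ → ℝ)) => p.2.2 i :=
    fun i => (measurable_pi_apply i).comp (measurable_snd.comp measurable_snd)
  have hexp : Measurable fun x : ℝ => ENNReal.ofReal (Real.exp (-t * x)) := by fun_prop
  have hHm : Measurable H := by
    refine (measurable_fst.comp measurable_fst).mul (Measurable.tsum fun i => ?_)
    refine Measurable.ite (measurable_snd (measurableSet_lt_fst i)) ?_ measurable_const
    exact (hexp.comp (hcoord i)).mul
      (hφ.comp ((measurable_snd.comp measurable_fst).add (hcoord i)))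
  have hleft : ∑' i : ℕ, B.tiltedMean t w φ (i :: u) =
      ∫⁻ ω, H ((A ω, B.V ω u), B.reproduction u ω) ∂P := by
    simp only [tiltedMean]
    rw [← lintegral_tsum fun i =>
      ((B.measurable_tiltedMean_integrand t hw hφ (i :: u)).mono (B.past_le _) le_rfl).aemeasurable]
    refine lintegral_congr fun ω => ?_
    simp only [hH, hA]
    rw [← ENNReal.tsum_mul_left]
    refine tsum_congr fun i => ?_
    simp only [Set.indicator, Set.mem_ofPred_eq, Alive, V, weight, reproduction, mul_add,
      Real.exp_add]
    rw [ENNReal.ofReal_mul (Real.exp_pos _).le]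
    by_cases h1 : B.Alive ω u <;> by_cases h2 : (i : ℕ∞) < B.numChildren u ω <;> simp [h1, h2]
    ring
  rw [hleft, ← lintegral_map (f := H) hHm
    (hAV.mono (B.past_le u) le_rfl |>.prodMk (B.measurable_reproduction u)),
    (indepFun_iff_map_prod_eq_prod_map_map
      (hAV.mono (B.past_le u) le_rfl).aemeasurable
      (B.measurable_reproduction u).aemeasurable).1 hind]
  have : IsProbabilityMeasure (P.map (B.reproduction u)) :=
    Measure.isProbabilityMeasure_map (B.measurable_reproduction u).aemeasurable
  rw [lintegral_prod _ hHm.aemeasurable, lintegral_map hHm.lintegral_prod_right'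
    (hAV.mono (B.past_le u) le_rfl), tiltedMean]
  refine lintegral_congr fun ω => ?_
  have hstep : ∫⁻ r, H ((A ω, B.V ω u), r) ∂(P.map (B.reproduction u)) =
      A ω * ∫⁻ y, φ (B.V ω u + y) ∂(expTilt B.mu t) := by
    have hφ' : Measurable fun y => φ (B.V ω u + y) := by fun_prop
    rw [expTilt, lintegral_withDensity_eq_lintegral_mul _ hexp hφ',
      B.lintegral_mu (hexp.mul hφ'), map_reproduction]
    simp only [hH]
    rw [lintegral_const_mul]
    · rfl
    · exact Measurable.tsum fun i => Measurable.ite (measurableSet_lt_fst i)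
        ((hexp.mul hφ').comp ((measurable_pi_apply i).comp measurable_snd)) measurable_const
  rw [hstep, hA]
  simp only [Set.indicator]
  split_ifs
  · ring
  · simp

/-- By the one-step formula, a supersolution `f` on the real line makes `B.tiltedMean t w f`
superharmonic on the tree with defect at least `B.tiltedMean t w h`. All later work thus takes place
on the line. -/
theorem tsum_tiltedMean_le (B : BranchingRandomWalk P) [IsProbabilityMeasure P] (t : ℝ)
    {w h f : ℝ → ℝ≥0∞} (hw : Measurable w) (hh : Measurable h) (hf : Measurable f)
    (hle : ∀ x, h x + w x * ∫⁻ y, f (x + y) ∂(expTilt B.mu t) ≤ f x) :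
    ∑' u, B.tiltedMean t w h u ≤ f 0 := by
  have h0 : B.tiltedMean t w f [] = f 0 := by
    simp [tiltedMean, Alive, V, weight]
  rw [← h0]
  refine tsum_le_root_of_superharmonic fun u => ?_
  rw [B.tsum_tiltedMean_children t hw hf u, tiltedMean, tiltedMean, tiltedMean, ← lintegral_add_left
    ((B.measurable_tiltedMean_integrand t hw hh u).mono (B.past_le _) le_rfl)]
  refine lintegral_mono fun ω => ?_
  simp only [Set.indicator]
  split_ifs
  · rw [← mul_add]
    gcongr
    exact hle _
  · simp

/-- The first moment bound for the existence of a particle. -/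
theorem mul_measure_le_of_exists (B : BranchingRandomWalk P) [IsProbabilityMeasure P] (t : ℝ)
    {w h f : ℝ → ℝ≥0∞} (hw : Measurable w) (hh : Measurable h) (hf : Measurable f)
    (hle : ∀ x, h x + w x * ∫⁻ y, f (x + y) ∂(expTilt B.mu t) ≤ f x) (c : ℝ≥0∞) {S : Set Ω}
    (hS : ∀ ω ∈ S, ∃ u, B.Alive ω u ∧
      c ≤ ENNReal.ofReal (Real.exp (-t * B.V ω u)) * B.weight w ω u * h (B.V ω u)) :
    c * P S ≤ f 0 := by
  refine le_trans ?_ (B.tsum_tiltedMean_le t hw hh hf hle)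
  have hm := fun u => (B.measurable_tiltedMean_integrand t hw hh u).mono (B.past_le _) le_rfl
  simp only [tiltedMean]
  rw [← lintegral_tsum fun u => (hm u).aemeasurable]
  -- Markov's inequality for the sum over all vertices, which dominates its term at the given
  -- particle.
  refine le_trans ?_ (mul_meas_ge_le_lintegral (Measurable.tsum hm) c)
  gcongr
  intro ω hω
  obtain ⟨u, hu, hc⟩ := hS ω hω
  refine le_trans ?_ (ENNReal.le_tsum u)
  rwa [Set.indicator_of_mem (by exact hu)]

end BranchingRandomWalk

/-! ### Rays, lowest positions and the tail of the local time. -/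

theorem suffix_cons_ne_iff {i : ℕ} {u v : Vertex} : (v <:+ i :: u ∧ v ≠ i :: u) ↔ v <:+ u := by
  rw [List.suffix_cons_iff]
  constructor
  · rintro ⟨rfl | h, hne⟩
    · exact absurd rfl hne
    · exact h
  · intro h
    refine ⟨Or.inr h, fun he => ?_⟩
    have := h.length_le
    rw [he] at this
    simp at this

namespace BranchingRandomWalk

variable {Ω : Type*} [MeasurableSpace Ω] {P : Measure Ω}

theorem Alive.of_suffix {B : BranchingRandomWalk P} {ω : Ω} {u v : Vertex} (hu : B.Alive ω u)
    (h : v <:+ u) : B.Alive ω v := by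
  induction u with
  | nil => rw [List.suffix_nil.1 h]; trivial
  | cons i u ih =>
    rcases List.suffix_cons_iff.1 h with rfl | h
    · exact hu
    · exact ih hu.1 h

theorem alive_of_mem_ray {B : BranchingRandomWalk P} {ω : Ω} {ξ : Set Vertex}
    (hξ : IsRay (B.tree ω) ξ) {u : Vertex} (hu : u ∈ ξ) : B.Alive ω u := by
  rcases hξ with ⟨v, hv, -, rfl⟩ | ⟨x, -, hx, -, rfl⟩
  · exact Alive.of_suffix hv hu
  · obtain ⟨n, rfl⟩ := hu
    exact hx n

theorem suffix_of_mem_ray {T ξ : Set Vertex} (hξ : IsRay T ξ) {u v : Vertex} (hu : u ∈ ξ)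
    (hv : v ∈ ξ) (hlen : v.length ≤ u.length) : v <:+ u := by
  rcases hξ with ⟨w, -, -, rfl⟩ | ⟨x, h0, -, hx, rfl⟩
  · exact List.suffix_of_suffix_length_le hv hu hlen
  · have hl : ∀ n, (x n).length = n := by
      intro n
      induction n with
      | zero => simp [h0]
      | succ n ih =>
        obtain ⟨i, hi⟩ := hx n
        simp [hi, ih]
    obtain ⟨m, rfl⟩ := hv
    obtain ⟨n, rfl⟩ := hu
    rw [hl, hl] at hlen
    induction n, hlen using Nat.le_induction with
    | base => exact List.suffix_rfl
    | succ n _ ih =>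
      obtain ⟨i, hi⟩ := hx n
      rw [hi]
      exact ih.trans (List.suffix_cons i _)

/-- If the local time exceeds `m` along some ray, then some particle at this level has `m` strict
ancestors at the same level. -/
theorem exists_alive_of_lt_supLocalTime {B : BranchingRandomWalk P} {ω : Ω} {k : ℤ} {m : ℕ}
    (h : (m : ℝ≥0∞) < B.supLocalTime ω k) :
    ∃ u, B.Alive ω u ∧ B.V ω u ∈ Set.Ico (k : ℝ) (k + 1) ∧ ∃ s : Finset Vertex, s.card = m ∧
      ∀ v ∈ s, v <:+ u ∧ v ≠ u ∧ B.V ω v ∈ Set.Ico (k : ℝ) (k + 1) := by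
  simp only [supLocalTime, lt_iSup_iff] at h
  obtain ⟨ξ, hξ, hm⟩ := h
  have hm' : (m : ℕ∞) < B.localTime ω ξ k := by exact_mod_cast hm
  have hm'' : ((m + 1 : ℕ) : ℕ∞) ≤ B.localTime ω ξ k := by
    push_cast
    exact Order.add_one_le_of_lt hm'
  obtain ⟨t, hts, htc⟩ := Set.exists_subset_encard_eq hm''
  have htf : t.Finite := Set.finite_of_encard_eq_coe htc
  have hcard : htf.toFinset.card = m + 1 := by
    have := htf.encard_eq_coe_toFinset_card
    rw [htc] at this
    exact_mod_cast this.symm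
  have hne : htf.toFinset.Nonempty := by
    rw [← Finset.card_pos]
    omega
  -- Of `m + 1` vertices of one ray, the deepest has the other `m` as strict ancestors.
  obtain ⟨u, hu, hmax⟩ := htf.toFinset.exists_max_image List.length hne
  have hmem : ∀ v ∈ htf.toFinset, v ∈ ξ ∧ B.V ω v ∈ Set.Ico (k : ℝ) (k + 1) :=
    fun v hv => hts (htf.mem_toFinset.1 hv)
  refine ⟨u, alive_of_mem_ray hξ (hmem u hu).1, (hmem u hu).2, htf.toFinset.erase u, ?_, ?_⟩
  · rw [Finset.card_erase_of_mem hu, hcard]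
    simp
  · intro v hv
    rw [Finset.mem_erase] at hv
    exact ⟨suffix_of_mem_ray hξ (hmem u hu).1 (hmem v hv.2).1 (hmax v hv.2), hv.1,
      (hmem v hv.2).2⟩

/-- Factors at least `1` can be dropped from the product, which leaves those at the vertices of `s`.
-/
theorem pow_card_le_weight {B : BranchingRandomWalk P} {w : ℝ → ℝ≥0∞} {ω : Ω} {ρ : ℝ≥0∞}
    {u : Vertex} (h1 : ∀ v, v <:+ u → v ≠ u → 1 ≤ w (B.V ω v)) (s : Finset Vertex)
    (hs : ∀ v ∈ s, v <:+ u ∧ v ≠ u ∧ ρ ≤ w (B.V ω v)) : ρ ^ s.card ≤ B.weight w ω u := by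
  induction u generalizing s with
  | nil =>
    have : s = ∅ := Finset.eq_empty_of_forall_notMem fun v hv =>
      (hs v hv).2.1 (List.suffix_nil.1 (hs v hv).1)
    simp [this, weight]
  | cons i u ih =>
    have h1' : ∀ v, v <:+ u → 1 ≤ w (B.V ω v) := fun v hv =>
      h1 v (suffix_cons_ne_iff.2 hv).1 (suffix_cons_ne_iff.2 hv).2
    have hsub : ∀ v ∈ s, v <:+ u := fun v hv =>
      suffix_cons_ne_iff.1 ⟨(hs v hv).1, (hs v hv).2.1⟩
    have hstep := ih (fun v hv _ => h1' v hv) (s.erase u) fun v hv => by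
      rw [Finset.mem_erase] at hv
      exact ⟨hsub v hv.2, hv.1, (hs v hv.2).2.2⟩
    rw [weight]
    by_cases hu : u ∈ s
    · rw [← Finset.card_erase_add_one hu, pow_succ]
      exact mul_le_mul' hstep (hs u hu).2.2
    · rw [Finset.erase_eq_of_notMem hu] at hstep
      calc ρ ^ s.card = ρ ^ s.card * 1 := (mul_one _).symm
        _ ≤ _ := mul_le_mul' hstep (h1' u List.suffix_rfl)

theorem le_exp_mul {t a v : ℝ} (ht : 0 ≤ t) (hv : v ≤ a) :
    ENNReal.ofReal (Real.exp (-t * a)) ≤ ENNReal.ofReal (Real.exp (-t * v)) :=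
  ENNReal.ofReal_le_ofReal (Real.exp_le_exp.2 (by nlinarith))

/-- The probability that some particle is to the left of `-a` is at most `e^{-ta}`. -/
theorem mul_measure_exists_lt_le (B : BranchingRandomWalk P) [IsProbabilityMeasure P] {t : ℝ}
    (ht : 0 ≤ t) [IsProbabilityMeasure (expTilt B.mu t)] (a : ℝ) :
    ENNReal.ofReal (Real.exp (t * a)) * P {ω | ∃ u, B.Alive ω u ∧ B.V ω u < -a} ≤ 1 := by
  classical
  -- Killing below `-a` makes `h` count only the first particle below `-a` on each line of descent;
  -- the constant `1` then solves the equation exactly.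
  set w : ℝ → ℝ≥0∞ := fun x => if x < -a then 0 else 1 with hw
  have hwm : Measurable w := Measurable.ite measurableSet_Iio measurable_const measurable_const
  set h : ℝ → ℝ≥0∞ := fun x => if x < -a then 1 else 0 with hh
  have hhm : Measurable h := Measurable.ite measurableSet_Iio measurable_const measurable_const
  refine B.mul_measure_le_of_exists t hwm hhm (f := fun _ => 1) measurable_const ?_ _ ?_
  · intro x
    by_cases hx : x < -a <;> simp [hw, hh, hx]
  · rintro ω ⟨u, hu, hlt⟩
    have key : ∀ u, B.Alive ω u → B.weight w ω u = 1 ∨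
        ∃ v, B.Alive ω v ∧ B.V ω v < -a ∧ B.weight w ω v = 1 := by
      intro u hu
      induction u with
      | nil => exact Or.inl rfl
      | cons i u ih =>
        rcases ih hu.1 with h1 | h1
        · by_cases hx : B.V ω u < -a
          · exact Or.inr ⟨u, hu.1, hx, h1⟩
          · left
            rw [weight, h1]
            simp [hw, hx]
        · exact Or.inr h1
    obtain ⟨v, hv, hvlt, hvw⟩ : ∃ v, B.Alive ω v ∧ B.V ω v < -a ∧ B.weight w ω v = 1 := by
      rcases key u hu with h1 | h1
      · exact ⟨u, hu, hlt, h1⟩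
      · exact h1
    refine ⟨v, hv, ?_⟩
    have := le_exp_mul ht hvlt.le
    simpa [hvw, hh, hvlt] using this

/-- A bound `G` for the Green function of the tilted random walk killed to the left of `-n` gives a
geometric tail for the local time at `n`. -/
theorem mul_measure_lt_supLocalTime_le (B : BranchingRandomWalk P) [IsProbabilityMeasure P] {t : ℝ}
    (ht : 0 ≤ t) [IsProbabilityMeasure (expTilt B.mu t)] (n : ℕ) {G : ℝ≥0∞}
    {g : ℝ → ℝ≥0∞} (hg : Measurable g) (hgG : ∀ x, g x ≤ G)
    (hsup : ∀ x, (Set.Ico (n : ℝ) (n + 1)).indicator 1 x +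
      (Set.Ici (-n : ℝ)).indicator (fun x => ∫⁻ y, g (x + y) ∂(expTilt B.mu t)) x ≤ g x) (m : ℕ) :
    ENNReal.ofReal (Real.exp (-t * (n + 1))) * (1 + 1 / (2 * G)) ^ m *
      P {ω | (∀ u, B.Alive ω u → (-n : ℝ) ≤ B.V ω u) ∧ (m : ℝ≥0∞) < B.supLocalTime ω n} ≤
      1 + 2 * G := by
  classical
  -- This reward is small enough for `1 + 2 * g` to remain a supersolution. With `p` the mean of `g`
  -- after one step from a point of the level, `1 + 2p ≤ 2(1 + p) ≤ 2G`, so the excess `(1 + 2p) /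
  -- (2G)` is at most `1`.
  set ρ : ℝ≥0∞ := 1 + 1 / (2 * G) with hρ
  set w : ℝ → ℝ≥0∞ := fun x => if x ∈ Set.Ico (n : ℝ) (n + 1) then ρ else
    if x ∈ Set.Ici (-n : ℝ) then 1 else 0 with hw
  have hwm : Measurable w := Measurable.ite measurableSet_Ico measurable_const
    (Measurable.ite measurableSet_Ici measurable_const measurable_const)
  have hn0 : (0 : ℝ) ≤ n := n.cast_nonneg
  have hint : ∀ x, ∫⁻ y, (1 + 2 * g (x + y)) ∂(expTilt B.mu t) =
      1 + 2 * ∫⁻ y, g (x + y) ∂(expTilt B.mu t) := by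
    intro x
    rw [lintegral_add_left measurable_const, lintegral_const_mul _ (by fun_prop)]
    simp
  refine le_trans (B.mul_measure_le_of_exists t hwm
    (h := (Set.Ico (n : ℝ) (n + 1)).indicator 1) (f := fun x => 1 + 2 * g x)
    (measurable_one.indicator measurableSet_Ico) (by fun_prop) ?_ _ ?_) (b := 1 + 2 * g 0) ?_
  · intro x
    rw [hint]
    have hx := hsup x
    set p := ∫⁻ y, g (x + y) ∂(expTilt B.mu t)
    by_cases hI : x ∈ Set.Ico (n : ℝ) (n + 1)
    · have hD : x ∈ Set.Ici (-n : ℝ) := by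
        have := hI.1
        simp only [Set.mem_Ici]
        linarith
      rw [Set.indicator_of_mem hI, Set.indicator_of_mem hD] at hx
      simp only [Pi.one_apply] at hx
      rw [Set.indicator_of_mem hI]
      simp only [hw, if_pos hI, Pi.one_apply, hρ]
      have h2 : 1 + 2 * p ≤ 2 * G :=
        calc 1 + 2 * p ≤ 2 * (1 + p) := by
              rw [mul_add]
              gcongr
              norm_num
          _ ≤ 2 * G := by gcongr; exact hx.trans (hgG x)
      calc 1 + (1 + 1 / (2 * G)) * (1 + 2 * p)
          = 1 + (1 + 2 * p) + (1 + 2 * p) / (2 * G) := by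
            rw [ENNReal.div_eq_inv_mul, ENNReal.div_eq_inv_mul]
            ring
        _ ≤ 1 + (1 + 2 * p) + 1 := by
            gcongr
            exact ENNReal.div_le_of_le_mul (by simpa using h2)
        _ = 1 + 2 * (1 + p) := by ring
        _ ≤ 1 + 2 * g x := by gcongr
    · rw [Set.indicator_of_notMem hI, zero_add] at hx
      rw [Set.indicator_of_notMem hI, zero_add]
      by_cases hD : x ∈ Set.Ici (-n : ℝ)
      · rw [Set.indicator_of_mem hD] at hx
        simp only [hw, if_neg hI, if_pos hD, one_mul]
        gcongr
      · simp only [hw, if_neg hI, if_neg hD, zero_mul, zero_le]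
  · rintro ω ⟨hV, hm⟩
    obtain ⟨u, hu, huI, s, hsc, hs⟩ := exists_alive_of_lt_supLocalTime
      (k := (n : ℤ)) hm
    simp only [Int.cast_natCast] at huI hs
    refine ⟨u, hu, ?_⟩
    rw [Set.indicator_of_mem huI, Pi.one_apply, mul_one]
    refine mul_le_mul' (le_exp_mul ht huI.2.le) ?_
    rw [← hsc]
    refine pow_card_le_weight (fun v hv _ => ?_) s fun v hv => ⟨(hs v hv).1, (hs v hv).2.1, ?_⟩
    · have hD : B.V ω v ∈ Set.Ici (-n : ℝ) := hV v (hu.of_suffix hv)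
      simp only [hw, if_pos hD]
      split_ifs
      · rw [hρ]; exact le_self_add
      · exact le_rfl
    · simp only [hw, if_pos (hs v hv).2.2]; exact le_rfl
  · gcongr
    exact hgG 0

end BranchingRandomWalk

/-! ### From Green function bounds to almost sure growth of local times. -/

namespace BranchingRandomWalk

variable {Ω : Type*} [MeasurableSpace Ω] {P : Measure Ω}

/-- Bernoulli's inequality: `n ^ j` factors already give `1 + 1 / (2 * C)`. The rate `2 * t` is
chosen to beat the cost `e^{t(n+1)}` of the tilt at level `n`. -/
theorem ofReal_le_one_add_inv_pow {C t : ℝ} (hC : 0 < C) {A j n : ℕ} (hn : 1 ≤ n)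
    (hA : Real.exp (2 * t) ≤ (1 + 1 / (2 * C)) ^ A) :
    ENNReal.ofReal (Real.exp (2 * t * n)) ≤
      (1 + 1 / (2 * ENNReal.ofReal (C * n ^ j))) ^ (A * n ^ (j + 1)) := by
  have hn' : (0 : ℝ) < n := by exact_mod_cast hn
  have hx : 0 < C * (n : ℝ) ^ j := by positivity
  have h1 : (1 : ℝ≥0∞) + 1 / (2 * ENNReal.ofReal (C * n ^ j)) =
      ENNReal.ofReal (1 + 1 / (2 * (C * n ^ j))) := by
    rw [ENNReal.ofReal_add zero_le_one (by positivity), ENNReal.ofReal_div_of_pos (by positivity),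
      ENNReal.ofReal_mul (by norm_num : (0 : ℝ) ≤ 2)]
    simp
  rw [h1, ← ENNReal.ofReal_pow (by positivity)]
  apply ENNReal.ofReal_le_ofReal
  have h2 : 1 + 1 / (2 * C) ≤ (1 + 1 / (2 * (C * (n : ℝ) ^ j))) ^ (n ^ j) := by
    refine le_trans (le_of_eq ?_) (one_add_mul_le_pow
      (le_trans (by norm_num) (by positivity : 0 ≤ 1 / (2 * (C * (n : ℝ) ^ j)))) (n ^ j))
    push_cast
    field_simp
  calc Real.exp (2 * t * n) = Real.exp (2 * t) ^ n := by rw [← Real.exp_nat_mul]; ring_nf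
    _ ≤ ((1 + 1 / (2 * C)) ^ A) ^ n := by gcongr
    _ ≤ (((1 + 1 / (2 * (C * (n : ℝ) ^ j))) ^ (n ^ j)) ^ A) ^ n := by gcongr
    _ = _ := by rw [← pow_mul, ← pow_mul]; congr 1; ring

theorem ae_eventually_supLocalTime_le (B : BranchingRandomWalk P) [IsProbabilityMeasure P] {t : ℝ}
    (ht : 0 < t) [IsProbabilityMeasure (expTilt B.mu t)] (j : ℕ) {C : ℝ} (hC : 0 < C)
    (hgreen : ∀ᶠ n : ℕ in atTop, ∃ g : ℝ → ℝ≥0∞, Measurable g ∧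
      (∀ x, g x ≤ ENNReal.ofReal (C * n ^ j)) ∧
      ∀ x, (Set.Ico (n : ℝ) (n + 1)).indicator 1 x +
        (Set.Ici (-n : ℝ)).indicator (fun x => ∫⁻ y, g (x + y) ∂(expTilt B.mu t)) x ≤ g x) :
    ∃ A : ℕ, ∀ᵐ ω ∂P, ∀ᶠ n : ℕ in atTop,
      B.supLocalTime ω n ≤ (A : ℝ≥0∞) * (n : ℝ≥0∞) ^ (j + 1) := by
  obtain ⟨A, hA⟩ : ∃ A : ℕ, Real.exp (2 * t) < (1 + 1 / (2 * C)) ^ A :=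
    pow_unbounded_of_one_lt _ (by simp [hC])
  refine ⟨A, ?_⟩
  obtain ⟨n₀, hn₀⟩ := eventually_atTop.1 (hgreen.and (eventually_ge_atTop 1))
  -- The condition `n₀ ≤ n` empties the first sets, so that a single bound holds for all `n`.
  set S : ℕ → Set Ω := fun n => {ω | n₀ ≤ n ∧ ((∃ u, B.Alive ω u ∧ B.V ω u < -n) ∨
    ((A * n ^ (j + 1) : ℕ) : ℝ≥0∞) < B.supLocalTime ω n)} with hS
  -- The first term bounds the probability of a particle below `-n`; the others are `e^{t(n+1) -
  -- 2tn} (1 + 2 C n^j)`, expanded.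
  set b : ℕ → ℝ := fun n => Real.exp (-t * n) + (Real.exp t * ((n : ℝ) ^ 0 * Real.exp (-t * n)) +
    2 * C * Real.exp t * ((n : ℝ) ^ j * Real.exp (-t * n))) with hb
  have hbs : Summable b := by
    have h0 := Real.summable_pow_mul_exp_neg_nat_mul 0 ht
    have hj := Real.summable_pow_mul_exp_neg_nat_mul j ht
    refine Summable.add ?_ ((h0.mul_left _).add (hj.mul_left _))
    simpa using h0
  have hle : ∀ n, P (S n) ≤ ENNReal.ofReal (b n) := by
    intro n
    by_cases hn : n₀ ≤ n
    swap
    · simp [hS, hn]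
    obtain ⟨⟨g, hg, hgG, hsup⟩, hn1⟩ := hn₀ n hn
    have hsub : S n ⊆ {ω | ∃ u, B.Alive ω u ∧ B.V ω u < -n} ∪
        {ω | (∀ u, B.Alive ω u → (-n : ℝ) ≤ B.V ω u) ∧
          ((A * n ^ (j + 1) : ℕ) : ℝ≥0∞) < B.supLocalTime ω n} := by
      rintro ω ⟨-, h⟩
      by_cases h1 : ∃ u, B.Alive ω u ∧ B.V ω u < -n
      · exact Or.inl h1
      · refine Or.inr ⟨fun u hu => ?_, h.resolve_left h1⟩
        by_contra! hlt
        exact h1 ⟨u, hu, hlt⟩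
    refine (measure_mono hsub).trans ((measure_union_le _ _).trans ?_)
    rw [hb, ENNReal.ofReal_add (by positivity) (by positivity)]
    refine add_le_add ?_ ?_
    · have h := B.mul_measure_exists_lt_le ht.le (n : ℝ)
      rw [mul_comm, ← ENNReal.le_div_iff_mul_le (by simp [Real.exp_pos]) (by simp)] at h
      refine h.trans (le_of_eq ?_)
      rw [one_div, ← ENNReal.ofReal_inv_of_pos (Real.exp_pos _), ← Real.exp_neg]
      ring_nf
    · have h := B.mul_measure_lt_supLocalTime_le ht.le n hg hgG hsup (A * n ^ (j + 1))
      have h2 : ENNReal.ofReal (Real.exp (-t * (n + 1))) * ENNReal.ofReal (Real.exp (2 * t * n)) *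
          P {ω | (∀ u, B.Alive ω u → (-n : ℝ) ≤ B.V ω u) ∧
            ((A * n ^ (j + 1) : ℕ) : ℝ≥0∞) < B.supLocalTime ω n} ≤
          ENNReal.ofReal (1 + 2 * (C * n ^ j)) := by
        refine (le_trans ?_ h).trans (le_of_eq ?_)
        · gcongr
          exact ofReal_le_one_add_inv_pow hC hn1 hA.le
        · rw [ENNReal.ofReal_add zero_le_one (by positivity),
            ENNReal.ofReal_mul (by norm_num : (0 : ℝ) ≤ 2)]
          simp
      rw [← ENNReal.ofReal_mul (Real.exp_pos _).le, ← Real.exp_add, mul_comm,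
        ← ENNReal.le_div_iff_mul_le (by simp [Real.exp_pos]) (by simp),
        ← ENNReal.ofReal_div_of_pos (Real.exp_pos _)] at h2
      refine h2.trans (ENNReal.ofReal_le_ofReal (le_of_eq ?_))
      rw [div_eq_mul_inv, ← Real.exp_neg,
        show -(-t * ((n : ℝ) + 1) + 2 * t * n) = t + -t * n by ring, Real.exp_add]
      ring
  have hsum : ∑' n, P (S n) ≠ ∞ :=
    ne_top_of_le_ne_top hbs.tsum_ofReal_ne_top (ENNReal.tsum_le_tsum hle)
  filter_upwards [ae_eventually_notMem hsum] with ω hω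
  filter_upwards [hω, eventually_ge_atTop n₀] with n hn hn'
  simp only [hS, Set.mem_ofPred_eq, not_and, not_or, not_lt] at hn
  exact_mod_cast (hn hn').2

theorem tendsto_supLocalTime_div {B : BranchingRandomWalk P} {ω : Ω} {A j : ℕ}
    (h : ∀ᶠ n : ℕ in atTop, B.supLocalTime ω n ≤ (A : ℝ≥0∞) * (n : ℝ≥0∞) ^ j) {κ : ℝ}
    (hκ : j < κ) :
    Tendsto (fun n : ℕ => B.supLocalTime ω n / (n : ℝ≥0∞) ^ κ) atTop (𝓝 0) := by
  have hlim : Tendsto (fun n : ℕ => ENNReal.ofReal (A * (n : ℝ) ^ (-(κ - j)))) atTop (𝓝 0) := by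
    have := ((tendsto_rpow_neg_atTop (sub_pos.2 hκ)).comp
      tendsto_natCast_atTop_atTop).const_mul (A : ℝ)
    simpa using ENNReal.tendsto_ofReal this
  refine tendsto_of_tendsto_of_tendsto_of_le_of_le' tendsto_const_nhds hlim
    (Eventually.of_forall fun _ => zero_le) ?_
  filter_upwards [h, eventually_ge_atTop 1] with n hn hn1
  have hn' : (0 : ℝ) < n := by exact_mod_cast hn1
  calc B.supLocalTime ω n / (n : ℝ≥0∞) ^ κ ≤ (A : ℝ≥0∞) * (n : ℝ≥0∞) ^ j / (n : ℝ≥0∞) ^ κ := by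
        gcongr
    _ = ENNReal.ofReal (A * (n : ℝ) ^ (-(κ - j))) := by
        rw [← ENNReal.ofReal_natCast n, ← ENNReal.ofReal_natCast A,
          ENNReal.ofReal_rpow_of_pos hn', ← ENNReal.ofReal_pow hn'.le,
          ← ENNReal.ofReal_mul (by positivity), ← ENNReal.ofReal_div_of_pos (by positivity)]
        congr 1
        rw [neg_sub, Real.rpow_sub hn', Real.rpow_natCast, mul_div_assoc]

end BranchingRandomWalk

/-! ### Green functions of killed random walks. -/

/-- The transition operator of the random walk with step distribution `ν`, killed outside `D`. -/
noncomputable def killedMean (ν : Measure ℝ) (D : Set ℝ) (φ : ℝ → ℝ≥0∞) : ℝ → ℝ≥0∞ :=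
  D.indicator fun x => ∫⁻ y, φ (x + y) ∂ν

/-- The expected number of visits to `I` before time `n` of the killed random walk. -/
noncomputable def partialGreen (ν : Measure ℝ) (D I : Set ℝ) : ℕ → ℝ → ℝ≥0∞
  | 0 => 0
  | n + 1 => I.indicator 1 + killedMean ν D (partialGreen ν D I n)

section killed

variable {ν : Measure ℝ} {D I : Set ℝ}

theorem measurable_killedMean [SFinite ν] (hD : MeasurableSet D) {φ : ℝ → ℝ≥0∞}
    (hφ : Measurable φ) : Measurable (killedMean ν D φ) := by
  refine Measurable.indicator ?_ hD
  exact (hφ.comp (measurable_fst.add measurable_snd)).lintegral_prod_right'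
    (f := fun p : ℝ × ℝ => φ (p.1 + p.2))

theorem measurable_iterate_killedMean [SFinite ν] (hD : MeasurableSet D) {φ : ℝ → ℝ≥0∞}
    (hφ : Measurable φ) (n : ℕ) : Measurable ((killedMean ν D)^[n] φ) := by
  induction n with
  | zero => exact hφ
  | succ n ih =>
    rw [Function.iterate_succ_apply']
    exact measurable_killedMean hD ih

theorem killedMean_mono : Monotone (killedMean ν D) := fun _ _ h _ =>
  Set.indicator_le_indicator (lintegral_mono fun _ => h _)

theorem killedMean_le_univ (φ : ℝ → ℝ≥0∞) : killedMean ν D φ ≤ killedMean ν Set.univ φ :=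
  fun x => by
    rw [killedMean, killedMean, Set.indicator_univ]
    exact Set.indicator_le_self _ _ _

theorem iterate_killedMean_le_univ (n : ℕ) (φ : ℝ → ℝ≥0∞) :
    (killedMean ν D)^[n] φ ≤ (killedMean ν Set.univ)^[n] φ := by
  induction n with
  | zero => exact le_rfl
  | succ n ih =>
    rw [Function.iterate_succ_apply', Function.iterate_succ_apply']
    exact (killedMean_mono ih).trans (killedMean_le_univ _)

theorem killedMean_add {φ ψ : ℝ → ℝ≥0∞} (hφ : Measurable φ) :
    killedMean ν D (φ + ψ) = killedMean ν D φ + killedMean ν D ψ := by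
  rw [killedMean, killedMean, killedMean, ← Set.indicator_add']
  congr 1
  ext x
  exact lintegral_add_left (by fun_prop) _

theorem killedMean_const_mul (c : ℝ≥0∞) {φ : ℝ → ℝ≥0∞} (hφ : Measurable φ) :
    killedMean ν D (fun x => c * φ x) = fun x => c * killedMean ν D φ x := by
  ext x
  simp only [killedMean, Set.indicator]
  split_ifs
  · exact lintegral_const_mul _ (by fun_prop)
  · simp

theorem iterate_killedMean_const_mul [SFinite ν] (hD : MeasurableSet D) (c : ℝ≥0∞)
    {φ : ℝ → ℝ≥0∞} (hφ : Measurable φ) (n : ℕ) :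
    (killedMean ν D)^[n] (fun x => c * φ x) = fun x => c * (killedMean ν D)^[n] φ x := by
  induction n with
  | zero => rfl
  | succ n ih =>
    simp only [Function.iterate_succ_apply']
    rw [ih, killedMean_const_mul c (measurable_iterate_killedMean hD hφ n)]

theorem measurable_partialGreen [SFinite ν] (hD : MeasurableSet D) (hI : MeasurableSet I) (n : ℕ) :
    Measurable (partialGreen ν D I n) := by
  induction n with
  | zero => exact measurable_zero
  | succ n ih => exact (measurable_one.indicator hI).add (measurable_killedMean hD ih)

theorem partialGreen_le_succ (n : ℕ) : partialGreen ν D I n ≤ partialGreen ν D I (n + 1) := by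
  induction n with
  | zero => intro x; exact zero_le
  | succ n ih => exact add_le_add le_rfl (killedMean_mono ih)

theorem monotone_partialGreen : Monotone (partialGreen ν D I) :=
  monotone_nat_of_le_succ partialGreen_le_succ

theorem partialGreen_le_univ (n : ℕ) : partialGreen ν D I n ≤ partialGreen ν Set.univ I n := by
  induction n with
  | zero => exact le_rfl
  | succ n ih => exact add_le_add le_rfl ((killedMean_mono ih).trans (killedMean_le_univ _))

/-- The Markov property at time `n`. -/
theorem partialGreen_add [SFinite ν] (hD : MeasurableSet D) (hI : MeasurableSet I) (n m : ℕ) :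
    partialGreen ν D I (n + m) =
      partialGreen ν D I n + (killedMean ν D)^[n] (partialGreen ν D I m) := by
  induction n with
  | zero => simp [partialGreen]
  | succ n ih =>
    rw [show n + 1 + m = n + m + 1 by omega, partialGreen, ih,
      killedMean_add (measurable_partialGreen hD hI n), Function.iterate_succ_apply',
      partialGreen, add_assoc]

theorem partialGreen_le_natCast [IsProbabilityMeasure ν] (n : ℕ) (x : ℝ) :
    partialGreen ν D I n x ≤ n := by
  induction n generalizing x with
  | zero => simp [partialGreen]
  | succ n ih =>
    rw [partialGreen, Pi.add_apply, Nat.cast_succ, add_comm]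
    refine add_le_add ?_ (Set.indicator_le_self' (fun _ _ => zero_le) x)
    refine (Set.indicator_le_self _ _ _).trans ((lintegral_mono fun y => ih (x + y)).trans ?_)
    simp

/-- A maximum principle: the Green function of the killed random walk is bounded if, starting from
`I`, there are boundedly many visits to `I` before time `N` and the probability to come back after
time `N` is bounded away from `1`. -/
theorem partialGreen_le [IsProbabilityMeasure ν] (hD : MeasurableSet D) (hI : MeasurableSet I)
    {u : ℝ → ℝ≥0∞} (hu : Measurable u) (hu1 : ∀ x, u x ≤ 1) (hIu : ∀ x ∈ I, 1 ≤ u x)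
    (hsup : killedMean ν D u ≤ u) {N : ℕ} {b q : ℝ≥0∞} (hq : q < 1)
    (hb : ∀ x ∈ I, partialGreen ν D I N x ≤ b)
    (hqu : ∀ x ∈ I, (killedMean ν D)^[N] u x ≤ q) (M : ℕ) (x : ℝ) :
    partialGreen ν D I M x ≤ b / (1 - q) := by
  set s : ℕ → ℝ≥0∞ := fun M => ⨆ x ∈ I, partialGreen ν D I M x with hs
  have hsM : ∀ M, s M ≤ M := fun M => iSup₂_le fun x _ => partialGreen_le_natCast M x
  -- Visits are counted only from the first entrance to `I`, and the supersolution `u`, at least `1`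
  -- on `I`, dominates the probability of entering.
  have hle : ∀ M x, partialGreen ν D I M x ≤ s M * u x := by
    intro M
    induction M with
    | zero => intro x; exact zero_le
    | succ M ih =>
      intro x
      by_cases hx : x ∈ I
      · calc partialGreen ν D I (M + 1) x ≤ s (M + 1) :=
              le_iSup₂ (f := fun x _ => partialGreen ν D I (M + 1) x) x hx
          _ = s (M + 1) * 1 := (mul_one _).symm
          _ ≤ _ := by gcongr; exact hIu x hx
      · rw [partialGreen, Pi.add_apply, Set.indicator_of_notMem hx, zero_add]
        calc killedMean ν D (partialGreen ν D I M) x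
            ≤ killedMean ν D (fun x => s M * u x) x := killedMean_mono ih x
          _ = s M * killedMean ν D u x := by rw [killedMean_const_mul _ hu]
          _ ≤ s (M + 1) * u x := by
            refine mul_le_mul' (iSup₂_mono fun x _ => ?_) (hsup x)
            exact partialGreen_le_succ M x
  have hrec : s M ≤ b + s M * q := by
    refine iSup₂_le fun x hx => ?_
    calc partialGreen ν D I M x ≤ partialGreen ν D I (N + M) x :=
          monotone_partialGreen (Nat.le_add_left M N) x
      _ = partialGreen ν D I N x + (killedMean ν D)^[N] (partialGreen ν D I M) x := by
          rw [partialGreen_add hD hI, Pi.add_apply]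
      _ ≤ b + (killedMean ν D)^[N] (fun x => s M * u x) x :=
          add_le_add (hb x hx) (killedMean_mono.iterate N (hle M) x)
      _ = b + s M * (killedMean ν D)^[N] u x := by rw [iterate_killedMean_const_mul hD _ hu]
      _ ≤ b + s M * q := by gcongr; exact hqu x hx
  -- Finiteness, which comes from counting only finitely many steps, allows `s M * q` to be absorbed
  -- on the left.
  have htop : s M ≠ ∞ := ne_top_of_le_ne_top (ENNReal.natCast_ne_top M) (hsM M)
  have hs1 : s M * (1 - q) ≤ b := by
    rw [ENNReal.mul_sub fun _ _ => htop, mul_one]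
    exact tsub_le_iff_right.2 hrec
  calc partialGreen ν D I M x ≤ s M * u x := hle M x
    _ ≤ s M * 1 := by gcongr; exact hu1 x
    _ = s M := mul_one _
    _ ≤ b / (1 - q) := (ENNReal.le_div_iff_mul_le (Or.inl (tsub_pos_of_lt hq).ne')
        (Or.inl (ENNReal.sub_ne_top ENNReal.one_ne_top))).2 hs1

/-- By monotone convergence the full Green function inherits the recursion; it is the `g` that the
tail bound for local times needs. -/
theorem exists_green [IsProbabilityMeasure ν] (hD : MeasurableSet D) (hI : MeasurableSet I)
    {G : ℝ≥0∞} (hG : ∀ M x, partialGreen ν D I M x ≤ G) :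
    ∃ g : ℝ → ℝ≥0∞, Measurable g ∧ (∀ x, g x ≤ G) ∧
      ∀ x, I.indicator 1 x + killedMean ν D g x ≤ g x := by
  refine ⟨fun x => ⨆ M, partialGreen ν D I M x,
    Measurable.iSup fun M => measurable_partialGreen hD hI M, fun x => iSup_le fun M => hG M x,
    fun x => ?_⟩
  have h : killedMean ν D (fun x => ⨆ M, partialGreen ν D I M x) x =
      ⨆ M, killedMean ν D (partialGreen ν D I M) x := by
    by_cases hx : x ∈ D
    · simp only [killedMean, Set.indicator_of_mem hx]
      refine lintegral_iSup (fun M => ?_) fun M M' hM y => monotone_partialGreen hM (x + y)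
      exact (measurable_partialGreen hD hI M).comp (measurable_const.add measurable_id)
    · simp [killedMean, hx]
  rw [h, ENNReal.add_iSup]
  exact iSup_le fun M => le_iSup (fun M => partialGreen ν D I M x) (M + 1)

end killed

/-! ### The random walk as a sequence of independent steps. -/

/-- The law of the sequence of steps of the random walk with step distribution `ν`. -/
noncomputable def stepsLaw (ν : Measure ℝ) [IsProbabilityMeasure ν] : Measure (ℕ → ℝ) :=
  Measure.infinitePi fun _ => ν

instance (ν : Measure ℝ) [IsProbabilityMeasure ν] : IsProbabilityMeasure (stepsLaw ν) := by
  unfold stepsLaw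
  infer_instance

/-- The sequence `y, z 0, z 1, …`. -/
def consSeq (p : ℝ × (ℕ → ℝ)) : ℕ → ℝ
  | 0 => p.1
  | n + 1 => p.2 n

theorem measurable_consSeq : Measurable consSeq := by
  refine measurable_pi_lambda _ fun n => ?_
  cases n with
  | zero => exact measurable_fst
  | succ n => exact (measurable_pi_apply n).comp measurable_snd

theorem map_consSeq (ν : Measure ℝ) [IsProbabilityMeasure ν] :
    (ν.prod (stepsLaw ν)).map consSeq = stepsLaw ν := by
  classical
  refine Measure.eq_infinitePi (fun _ => ν) fun s t ht => ?_
  -- Filling with `Set.univ` turns a cylinder over `s` into one over an initial segment, from which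
  -- the first coordinate splits off.
  set t' : ℕ → Set ℝ := fun i => if i ∈ s then t i else Set.univ with ht'
  have ht'm : ∀ i, MeasurableSet (t' i) := by
    intro i
    simp only [ht']
    split_ifs
    · exact ht i
    · exact MeasurableSet.univ
  obtain ⟨n, hn⟩ : ∃ n, s ⊆ Finset.range (n + 1) := by
    obtain ⟨n, hn⟩ := s.exists_nat_subset_range
    exact ⟨n, hn.trans (Finset.range_mono n.le_succ)⟩
  have hpi : consSeq ⁻¹' (Set.pi s t) =
      t' 0 ×ˢ (Set.pi (Finset.range n) fun i => t' (i + 1)) := by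
    ext ⟨y, z⟩
    simp only [Set.mem_preimage, Set.mem_pi, Set.mem_prod, Finset.mem_coe, Finset.mem_range, ht']
    constructor
    · intro h
      refine ⟨?_, fun i _ => ?_⟩
      · split_ifs with h0
        · exact h 0 h0
        · trivial
      · split_ifs with h0
        · exact h (i + 1) h0
        · trivial
    · rintro ⟨h0, h1⟩ i hi
      cases i with
      | zero => rwa [if_pos hi] at h0
      | succ i =>
        have hin := Finset.mem_range.1 (hn hi)
        have := h1 i (by omega)
        rwa [if_pos hi] at this
  rw [Measure.map_apply measurable_consSeq (MeasurableSet.pi s.countable_toSet fun i _ => ht i),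
    hpi, Measure.prod_prod, stepsLaw, Measure.infinitePi_pi (fun _ => ν) fun i _ => ht'm (i + 1),
    mul_comm, ← Finset.prod_range_succ' (fun i => ν (t' i)) n]
  rw [← Finset.prod_subset hn]
  · exact Finset.prod_congr rfl fun i hi => by rw [ht']; simp [hi]
  · intro i _ hi
    simp [ht', hi]

theorem lintegral_stepsLaw (ν : Measure ℝ) [IsProbabilityMeasure ν] {F : (ℕ → ℝ) → ℝ≥0∞}
    (hF : Measurable F) :
    ∫⁻ z, F z ∂(stepsLaw ν) = ∫⁻ y, ∫⁻ z, F (consSeq (y, z)) ∂(stepsLaw ν) ∂ν := by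
  conv_lhs => rw [← map_consSeq ν]
  rw [lintegral_map hF measurable_consSeq]
  exact lintegral_prod _ (hF.comp measurable_consSeq).aemeasurable

theorem sum_consSeq (y : ℝ) (z : ℕ → ℝ) (n : ℕ) :
    ∑ i ∈ Finset.range (n + 1), consSeq (y, z) i = y + ∑ i ∈ Finset.range n, z i := by
  rw [Finset.sum_range_succ', add_comm]
  rfl

theorem iterate_killedMean_univ {ν : Measure ℝ} [IsProbabilityMeasure ν] {φ : ℝ → ℝ≥0∞}
    (hφ : Measurable φ) (n : ℕ) (x : ℝ) : (killedMean ν Set.univ)^[n] φ x =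
      ∫⁻ z, φ (x + ∑ i ∈ Finset.range n, z i) ∂(stepsLaw ν) := by
  induction n generalizing x with
  | zero => simp
  | succ n ih =>
    rw [Function.iterate_succ_apply', lintegral_stepsLaw ν (by fun_prop), killedMean,
      Set.indicator_univ]
    refine lintegral_congr fun y => ?_
    rw [ih]
    refine lintegral_congr fun z => ?_
    rw [sum_consSeq, add_assoc]

/-- A sum of i.i.d. random variables whose mean is well-defined and positive (possibly infinite)
tends to infinity. -/
theorem ae_eventually_one_le_sum {Ω : Type*} [MeasurableSpace Ω] {Q : Measure Ω}
    [IsProbabilityMeasure Q] {X : ℕ → Ω → ℝ} (hm : ∀ i, Measurable (X i)) (hindep : iIndepFun X Q)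
    (hident : ∀ i, IdentDistrib (X i) (X 0) Q Q)
    (hlt : ∫⁻ ω, ENNReal.ofReal (-X 0 ω) ∂Q < ∫⁻ ω, ENNReal.ofReal (X 0 ω) ∂Q) :
    ∀ᵐ ω ∂Q, ∀ᶠ n : ℕ in atTop, 1 ≤ ∑ i ∈ Finset.range n, X i ω := by
  -- Truncation from above makes the mean finite, keeps it positive for large `b`, and only lowers
  -- the sums; the strong law applies to the truncated variables.
  obtain ⟨b, hb⟩ : ∃ b : ℕ, ∫⁻ ω, ENNReal.ofReal (-X 0 ω) ∂Q <
      ∫⁻ ω, ENNReal.ofReal (min (X 0 ω) b) ∂Q := by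
    have hsup : ∫⁻ ω, ENNReal.ofReal (X 0 ω) ∂Q =
        ⨆ b : ℕ, ∫⁻ ω, ENNReal.ofReal (min (X 0 ω) b) ∂Q := by
      rw [← lintegral_iSup]
      · refine lintegral_congr fun ω => le_antisymm ?_ ?_
        · obtain ⟨b, hb⟩ := exists_nat_ge (X 0 ω)
          refine le_iSup_of_le b ?_
          rw [min_eq_left hb]
        · exact iSup_le fun b => ENNReal.ofReal_le_ofReal (min_le_left _ _)
      · intro b
        have := hm 0
        fun_prop
      · intro b b' hbb ω
        refine ENNReal.ofReal_le_ofReal (min_le_min le_rfl ?_)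
        exact_mod_cast hbb
    rw [hsup] at hlt
    exact lt_iSup_iff.1 hlt
  set T : ℝ → ℝ := fun x => min x b with hT
  have hTm : Measurable T := by fun_prop
  have hneg : ∀ ω, ENNReal.ofReal (-T (X 0 ω)) = ENNReal.ofReal (-X 0 ω) := by
    intro ω
    have hb0 : (0 : ℝ) ≤ b := b.cast_nonneg
    simp only [hT]
    rcases le_total (X 0 ω) b with h | h
    · rw [min_eq_left h]
    · rw [min_eq_right h, ENNReal.ofReal_of_nonpos (by linarith),
        ENNReal.ofReal_of_nonpos (by linarith)]
  have hpos_lt : ∫⁻ ω, ENNReal.ofReal (T (X 0 ω)) ∂Q < ∞ := by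
    calc ∫⁻ ω, ENNReal.ofReal (T (X 0 ω)) ∂Q ≤ ∫⁻ _, (b : ℝ≥0∞) ∂Q := by
          refine lintegral_mono fun ω => ?_
          rw [← ENNReal.ofReal_natCast]
          exact ENNReal.ofReal_le_ofReal (min_le_right _ _)
      _ < ∞ := by simp
  have hneg_lt : ∫⁻ ω, ENNReal.ofReal (-T (X 0 ω)) ∂Q < ∞ := by
    simp only [hneg]
    exact hb.trans_le le_top
  have hint : Integrable (fun ω => T (X 0 ω)) Q := by
    refine ⟨(hTm.comp (hm 0)).aestronglyMeasurable, ?_⟩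
    rw [hasFiniteIntegral_iff_norm]
    calc ∫⁻ ω, ENNReal.ofReal ‖T (X 0 ω)‖ ∂Q
        ≤ ∫⁻ ω, (ENNReal.ofReal (T (X 0 ω)) + ENNReal.ofReal (-T (X 0 ω))) ∂Q := by
          refine lintegral_mono fun ω => ?_
          rcases le_total 0 (T (X 0 ω)) with h | h
          · rw [Real.norm_of_nonneg h]
            exact le_self_add
          · rw [Real.norm_of_nonpos h]
            exact le_add_self
      _ < ∞ := by
          have hTX : Measurable fun ω => ENNReal.ofReal (T (X 0 ω)) :=
            ENNReal.measurable_ofReal.comp (hTm.comp (hm 0))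
          rw [lintegral_add_left hTX]
          exact ENNReal.add_lt_top.2 ⟨hpos_lt, hneg_lt⟩
  have hmean : 0 < ∫ ω, T (X 0 ω) ∂Q := by
    rw [integral_eq_lintegral_pos_part_sub_lintegral_neg_part hint, sub_pos,
      ENNReal.toReal_lt_toReal hneg_lt.ne hpos_lt.ne]
    simp only [hneg]
    exact hb
  have hslln := strong_law_ae_real (fun i ω => T (X i ω)) hint
    (fun i j hij => (hindep.indepFun hij).comp hTm hTm) fun i => (hident i).comp hTm
  filter_upwards [hslln] with ω hω
  obtain ⟨n₀, hn₀⟩ := exists_nat_ge (2 / ∫ ω, T (X 0 ω) ∂Q)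
  filter_upwards [hω.eventually (lt_mem_nhds (half_lt_self hmean)), eventually_ge_atTop n₀,
    eventually_ge_atTop 1] with n hn hn' hn1
  have hnpos : (0 : ℝ) < n := by exact_mod_cast hn1
  have h2 : 2 / ∫ ω, T (X 0 ω) ∂Q ≤ n := hn₀.trans (by exact_mod_cast hn')
  rw [div_le_iff₀ hmean] at h2
  rw [lt_div_iff₀ hnpos] at hn
  have h3 : ∑ i ∈ Finset.range n, T (X i ω) ≤ ∑ i ∈ Finset.range n, X i ω :=
    Finset.sum_le_sum fun i _ => min_le_left _ _
  linarith

/-! ### Walks with drift. -/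

section walk

variable {ν : Measure ℝ} [IsProbabilityMeasure ν]

theorem iIndepFun_stepsLaw : iIndepFun (fun (i : ℕ) (z : ℕ → ℝ) => z i) (stepsLaw ν) :=
  iIndepFun_infinitePi (X := fun _ x => x) fun _ => measurable_id

theorem map_eval_stepsLaw (i : ℕ) : (stepsLaw ν).map (fun z => z i) = ν :=
  Measure.infinitePi_map_eval _ i

theorem identDistrib_stepsLaw (i : ℕ) :
    IdentDistrib (fun z : ℕ → ℝ => z i) (fun z => z 0) (stepsLaw ν) (stepsLaw ν) :=
  ⟨(measurable_pi_apply i).aemeasurable, (measurable_pi_apply 0).aemeasurable, by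
    rw [map_eval_stepsLaw, map_eval_stepsLaw]⟩

theorem lintegral_eval_stepsLaw {φ : ℝ → ℝ≥0∞} (hφ : Measurable φ) (i : ℕ) :
    ∫⁻ z, φ (z i) ∂(stepsLaw ν) = ∫⁻ y, φ y ∂ν := by
  rw [← lintegral_map (f := φ) hφ (measurable_pi_apply i), map_eval_stepsLaw]

theorem ae_eventually_one_le_abs_sum
    (h : ∫⁻ x, ENNReal.ofReal x ∂ν ≠ ∫⁻ x, ENNReal.ofReal (-x) ∂ν) :
    ∀ᵐ z ∂(stepsLaw ν), ∀ᶠ n : ℕ in atTop, 1 ≤ |∑ i ∈ Finset.range n, z i| := by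
  have hpos := lintegral_eval_stepsLaw (ν := ν) (φ := fun x => ENNReal.ofReal x) (by fun_prop) 0
  have hneg := lintegral_eval_stepsLaw (ν := ν) (φ := fun x => ENNReal.ofReal (-x)) (by fun_prop) 0
  rcases h.lt_or_gt with h | h
  · have hX := ae_eventually_one_le_sum (Q := stepsLaw ν) (X := fun i z => -z i)
      (fun i => (measurable_pi_apply i).neg)
      (iIndepFun_stepsLaw.comp (fun _ x => -x) fun _ => measurable_neg)
      (fun i => (identDistrib_stepsLaw i).comp measurable_neg)
      (by simpa only [neg_neg, hpos, hneg] using h)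
    filter_upwards [hX] with z hz
    filter_upwards [hz] with n hn
    rw [Finset.sum_neg_distrib] at hn
    exact hn.trans (neg_le_abs _)
  · have hX := ae_eventually_one_le_sum (Q := stepsLaw ν) (X := fun i z => z i)
      (fun i => measurable_pi_apply i) iIndepFun_stepsLaw identDistrib_stepsLaw
      (by simpa only [hpos, hneg] using h)
    filter_upwards [hX] with z hz
    filter_upwards [hz] with n hn
    exact hn.trans (le_abs_self _)

/-- The probability that the random walk started at `x` visits `I` at or after time `N`. -/
noncomputable def hittingProb (ν : Measure ℝ) [IsProbabilityMeasure ν] (I : Set ℝ) (N : ℕ)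
    (x : ℝ) : ℝ≥0∞ :=
  stepsLaw ν {z | ∃ n, N ≤ n ∧ x + ∑ i ∈ Finset.range n, z i ∈ I}

theorem measurableSet_hitting {I : Set ℝ} (hI : MeasurableSet I) (N : ℕ) :
    MeasurableSet {p : ℝ × (ℕ → ℝ) | ∃ n, N ≤ n ∧ p.1 + ∑ i ∈ Finset.range n, p.2 i ∈ I} := by
  simp only [← exists_prop, Set.ofPred_exists]
  refine MeasurableSet.iUnion fun n => MeasurableSet.iUnion fun _ => ?_
  have : Measurable fun p : ℝ × (ℕ → ℝ) => p.1 + ∑ i ∈ Finset.range n, p.2 i := by fun_prop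
  exact this hI

theorem measurable_hittingProb {I : Set ℝ} (hI : MeasurableSet I) (N : ℕ) :
    Measurable (hittingProb ν I N) :=
  measurable_measure_prodMk_left (measurableSet_hitting hI N)

/-- Averaging over a first step delays the earliest admissible visit by one. So `hittingProb ν I 0`
is a supersolution, and its `N`-th iterate is the probability of a visit at or after time `N`. -/
theorem killedMean_univ_hittingProb {I : Set ℝ} (hI : MeasurableSet I) (N : ℕ) :
    killedMean ν Set.univ (hittingProb ν I N) = hittingProb ν I (N + 1) := by
  ext x
  have hms : ∀ (N : ℕ) (x : ℝ),
      MeasurableSet {z : ℕ → ℝ | ∃ n, N ≤ n ∧ x + ∑ i ∈ Finset.range n, z i ∈ I} :=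
    fun N x => measurable_prodMk_left (measurableSet_hitting hI N)
  rw [killedMean, Set.indicator_univ, hittingProb, ← lintegral_indicator_one (hms _ _),
    lintegral_stepsLaw ν (measurable_one.indicator (hms _ _))]
  refine lintegral_congr fun y => ?_
  rw [hittingProb, ← lintegral_indicator_one (hms _ _)]
  refine lintegral_congr fun z => ?_
  -- Both integrands are indicators, so only the equivalence of the two hitting conditions is left.
  refine congrArg (fun p : Prop => Set.indicator {_a : Unit | p} (1 : Unit → ℝ≥0∞) ()) (propext ?_)
  constructor
  · rintro ⟨n, hn, h⟩
    refine ⟨n + 1, by omega, ?_⟩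
    rwa [sum_consSeq, ← add_assoc]
  · rintro ⟨n, hn, h⟩
    obtain ⟨n, rfl⟩ : ∃ m, n = m + 1 := ⟨n - 1, by omega⟩
    rw [sum_consSeq, ← add_assoc] at h
    exact ⟨n, by omega, h⟩

theorem hittingProb_antitone {I : Set ℝ} (x : ℝ) : Antitone fun N => hittingProb ν I N x :=
  fun _ _ h => measure_mono fun _ ⟨n, hn, hz⟩ => ⟨n, h.trans hn, hz⟩

/-- A random walk whose mean is well-defined and nonzero has a bounded Green function. -/
theorem exists_partialGreen_le_of_drift
    (h : ∫⁻ x, ENNReal.ofReal x ∂ν ≠ ∫⁻ x, ENNReal.ofReal (-x) ∂ν) :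
    ∃ N : ℕ, ∀ (a : ℝ) (M : ℕ) (x : ℝ),
      partialGreen ν Set.univ (Set.Ico a (a + 1)) M x ≤ N := by
  -- Two points of a half-open unit interval are at distance less than `1`, so `E N` contains every
  -- late return to `I` from `I`, uniformly in `a` and in the starting point.
  set E : ℕ → Set (ℕ → ℝ) := fun N => {z | ∃ n, N ≤ n ∧ |∑ i ∈ Finset.range n, z i| < 1} with hE
  have hEm : ∀ N, MeasurableSet (E N) := by
    intro N
    simp only [hE, ← exists_prop, Set.ofPred_exists]
    refine MeasurableSet.iUnion fun n => MeasurableSet.iUnion fun _ => ?_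
    exact measurableSet_lt (by fun_prop) measurable_const
  have hlim : Tendsto (fun N => stepsLaw ν (E N)) atTop (𝓝 0) := by
    have h0 : stepsLaw ν (⋂ N, E N) = 0 := by
      refine measure_mono_null ?_ (ae_eventually_one_le_abs_sum h)
      intro z hz hev
      obtain ⟨N, hN⟩ := eventually_atTop.1 hev
      obtain ⟨n, hn, hlt⟩ := Set.mem_iInter.1 hz N
      exact absurd (hN n hn) (not_le.2 hlt)
    rw [← h0]
    exact tendsto_measure_iInter_atTop (fun N => (hEm N).nullMeasurableSet)
      (fun N N' hN z ⟨n, hn, hz⟩ => ⟨n, hN.trans hn, hz⟩) ⟨0, measure_ne_top _ _⟩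
  obtain ⟨N, hN⟩ := (hlim.eventually (gt_mem_nhds (by norm_num : (0 : ℝ≥0∞) < 2⁻¹))).exists
  refine ⟨N * 2, fun a M x => ?_⟩
  have hI : MeasurableSet (Set.Ico a (a + 1)) := measurableSet_Ico
  have hbound := partialGreen_le (ν := ν) MeasurableSet.univ hI
    (u := hittingProb ν (Set.Ico a (a + 1)) 0) (measurable_hittingProb hI 0)
    (fun x => prob_le_one) (fun x hx => ?_) ?_ (N := N) (b := N) (q := 2⁻¹) (by norm_num)
    (fun x _ => partialGreen_le_natCast N x) (fun x hx => ?_) M x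
  · refine hbound.trans (le_of_eq ?_)
    rw [ENNReal.one_sub_inv_two, div_eq_mul_inv, inv_inv]
    push_cast
    rfl
  · have huniv : {z : ℕ → ℝ | ∃ n, 0 ≤ n ∧ x + ∑ i ∈ Finset.range n, z i ∈ Set.Ico a (a + 1)} =
        Set.univ := Set.eq_univ_of_forall fun z => ⟨0, le_rfl, by simpa using hx⟩
    rw [hittingProb, huniv, measure_univ]
  · rw [killedMean_univ_hittingProb hI]
    exact fun x => hittingProb_antitone x (Nat.zero_le 1)
  · have hit : ∀ k : ℕ, (killedMean ν Set.univ)^[k] (hittingProb ν (Set.Ico a (a + 1)) 0) =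
        hittingProb ν (Set.Ico a (a + 1)) k := by
      intro k
      induction k with
      | zero => rfl
      | succ k ih => rw [Function.iterate_succ_apply', ih, killedMean_univ_hittingProb hI]
    rw [hit]
    refine (measure_mono ?_).trans hN.le
    rintro z ⟨n, hn, hz⟩
    refine ⟨n, hn, ?_⟩
    rw [abs_lt]
    constructor <;> linarith [hx.1, hx.2, hz.1, hz.2]

end walk

/-! ### Centered walks with finite variance. -/

theorem sqrt_one_add_sq_add_le (b y : ℝ) : √(1 + (b + y) ^ 2) ≤ √(1 + b ^ 2) + |y| := by
  rw [Real.sqrt_le_left (by positivity)]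
  have h1 : |b| ≤ √(1 + b ^ 2) := Real.abs_le_sqrt (by linarith)
  have h2 : √(1 + b ^ 2) ^ 2 = 1 + b ^ 2 := Real.sq_sqrt (by positivity)
  have h3 : b * y ≤ |b| * |y| := by rw [← abs_mul]; exact le_abs_self _
  have h4 : |b| * |y| ≤ √(1 + b ^ 2) * |y| := by gcongr
  have h5 : |y| ^ 2 = y ^ 2 := sq_abs y
  nlinarith

/-- The tangent line inequality for `√(1 + x ^ 2)`, with a gain near the origin. For a centered step
the linear term averages out and the gain becomes a drift. With `r` the value, `c` the tangent and
`s = √(1 + b ^ 2)`, one has `(r - c)(r + c) = y ^ 2 / s ^ 2`, where `s ^ 2 ≤ 2` and `r + c ≤ 4 + 2 *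
|y|` if `|b| ≤ 1`. -/
theorem sqrt_one_add_sq_convex (b y : ℝ) :
    √(1 + b ^ 2) + b / √(1 + b ^ 2) * y + (if |b| ≤ 1 then y ^ 2 / (8 + 4 * |y|) else 0) ≤
      √(1 + (b + y) ^ 2) := by
  set s := √(1 + b ^ 2) with hs
  set r := √(1 + (b + y) ^ 2) with hr
  have hs2 : s ^ 2 = 1 + b ^ 2 := Real.sq_sqrt (by positivity)
  have hr2 : r ^ 2 = 1 + (b + y) ^ 2 := Real.sq_sqrt (by positivity)
  have hs1 : 1 ≤ s := by rw [hs, Real.one_le_sqrt]; nlinarith [sq_nonneg b]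
  have hr1 : 1 ≤ r := by rw [hr, Real.one_le_sqrt]; nlinarith [sq_nonneg (b + y)]
  have hs0 : 0 < s := by linarith
  set c := s + b / s * y with hc
  have hbs : (b / s) ^ 2 = 1 - 1 / s ^ 2 := by
    rw [div_pow, eq_sub_iff_add_eq, ← add_div, div_eq_one_iff_eq (by positivity)]
    linarith
  have hdiff : r ^ 2 - c ^ 2 = y ^ 2 / s ^ 2 := by
    have : c ^ 2 = s ^ 2 + 2 * b * y + (b / s) ^ 2 * y ^ 2 := by
      rw [hc]
      field_simp
      ring
    rw [this, hbs, hr2, hs2]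
    ring
  have hcr : |c| ≤ r := by
    have : 0 ≤ y ^ 2 / s ^ 2 := by positivity
    exact abs_le_of_sq_le_sq (by linarith) (by linarith)
  split_ifs with hb
  · have hb2 : b ^ 2 ≤ 1 := by rw [← sq_abs]; nlinarith [abs_nonneg b]
    have hsle : s ≤ 2 := by nlinarith
    have hrle : r ≤ 2 + |y| := (sqrt_one_add_sq_add_le b y).trans (by linarith)
    have h1 : (r - c) * (8 + 4 * |y|) ≥ y ^ 2 := by
      have h2 : (r - c) * (r + c) = y ^ 2 / s ^ 2 := by rw [← hdiff]; ring
      have h3 : y ^ 2 / 2 ≤ y ^ 2 / s ^ 2 := by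
        gcongr
        linarith
      have h4 : 0 ≤ r - c := by linarith [le_abs_self c]
      have h5 : r + c ≤ 4 + 2 * |y| := by linarith [le_abs_self c]
      nlinarith
    have h6 : y ^ 2 / (8 + 4 * |y|) ≤ r - c := by
      rw [div_le_iff₀ (by positivity)]
      exact h1
    linarith
  · linarith [le_abs_self c]

section walk

variable {ν : Measure ℝ} [IsProbabilityMeasure ν]

theorem integral_eval_stepsLaw {f : ℝ → ℝ} (hf : Measurable f) (i : ℕ) :
    ∫ z, f (z i) ∂(stepsLaw ν) = ∫ y, f y ∂ν := by
  have h := integral_map (μ := stepsLaw ν) (φ := fun z => z i)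
    (measurable_pi_apply i).aemeasurable (f := f) hf.aestronglyMeasurable
  rw [map_eval_stepsLaw] at h
  exact h.symm

theorem iterate_killedMean_sq (hL2 : MemLp (fun x : ℝ => x) 2 ν) (hmean : ∫ x, x ∂ν = 0) (n : ℕ)
    (x : ℝ) : (killedMean ν Set.univ)^[n] (fun x => ENNReal.ofReal (x ^ 2)) x =
      ENNReal.ofReal (x ^ 2 + n * ∫ y, y ^ 2 ∂ν) := by
  have hint : Integrable (fun x : ℝ => x) ν := hL2.integrable (by norm_num)
  have hsq : Integrable (fun x : ℝ => x ^ 2) ν := hL2.integrable_sq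
  have hv : 0 ≤ ∫ y, y ^ 2 ∂ν := integral_nonneg fun y => sq_nonneg y
  induction n generalizing x with
  | zero => simp
  | succ n ih =>
    rw [Function.iterate_succ_apply', killedMean, Set.indicator_univ]
    simp only [ih]
    have hexp : ∀ y : ℝ, (x + y) ^ 2 + n * ∫ y, y ^ 2 ∂ν =
        (x ^ 2 + n * ∫ y, y ^ 2 ∂ν) + (2 * x * y + y ^ 2) := fun y => by ring
    simp only [hexp]
    have hi : Integrable (fun y : ℝ => 2 * x * y + y ^ 2) ν := (hint.const_mul _).add hsq
    rw [← ofReal_integral_eq_lintegral_ofReal]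
    · rw [integral_add (integrable_const _) hi, integral_add (hint.const_mul _) hsq,
        integral_const_mul, hmean]
      congr 1
      simp
      ring
    · exact (integrable_const _).add hi
    · refine Eventually.of_forall fun y => ?_
      simp only [Pi.zero_apply]
      rw [← hexp]
      positivity

theorem lintegral_abs_sum_le (hL2 : MemLp (fun x : ℝ => x) 2 ν) (hmean : ∫ x, x ∂ν = 0) {r : ℕ}
    (hr : 1 ≤ r) : ∫⁻ z, ENNReal.ofReal |∑ i ∈ Finset.range (r ^ 2), z i| ∂(stepsLaw ν) ≤
      ENNReal.ofReal ((1 + ∫ y, y ^ 2 ∂ν) * r) := by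
  have hr0 : (0 : ℝ) < r := by exact_mod_cast hr
  have hv : 0 ≤ ∫ y, y ^ 2 ∂ν := integral_nonneg fun y => sq_nonneg y
  have h := iterate_killedMean_sq hL2 hmean (r ^ 2) 0
  rw [iterate_killedMean_univ (by fun_prop)] at h
  simp only [zero_add] at h
  calc ∫⁻ z, ENNReal.ofReal |∑ i ∈ Finset.range (r ^ 2), z i| ∂(stepsLaw ν)
      -- The elementary bound `|s| ≤ r + s ^ 2 / r`, balanced because the second moment at time `r ^
      -- 2` is of order `r ^ 2`.
      ≤ ∫⁻ z, (ENNReal.ofReal r + ENNReal.ofReal (r⁻¹) *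
          ENNReal.ofReal ((∑ i ∈ Finset.range (r ^ 2), z i) ^ 2)) ∂(stepsLaw ν) := by
        refine lintegral_mono fun z => ?_
        set s := ∑ i ∈ Finset.range (r ^ 2), z i
        rw [← ENNReal.ofReal_mul (by positivity), ← ENNReal.ofReal_add hr0.le (by positivity)]
        refine ENNReal.ofReal_le_ofReal ?_
        rw [← sq_abs s, ← mul_le_mul_iff_right₀ hr0]
        have : (r : ℝ) * (r + (r : ℝ)⁻¹ * |s| ^ 2) = r ^ 2 + |s| ^ 2 := by
          field_simp
        rw [this]
        nlinarith [sq_nonneg ((r : ℝ) - |s|), abs_nonneg s]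
    _ = ENNReal.ofReal ((1 + ∫ y, y ^ 2 ∂ν) * r) := by
        rw [lintegral_add_left measurable_const, lintegral_const_mul _ (by fun_prop), h,
          lintegral_const, measure_univ, mul_one, ← ENNReal.ofReal_mul (by positivity),
          ← ENNReal.ofReal_add hr0.le (by positivity)]
        congr 1
        push_cast
        field_simp
        ring

/-- A centered random walk with finite variance makes `O(r)` visits to a unit interval before time
`r ^ 2`. -/
theorem exists_partialGreen_sq_le (hL2 : MemLp (fun x : ℝ => x) 2 ν) (hmean : ∫ x, x ∂ν = 0)
    (hv : 0 < ∫ y, y ^ 2 ∂ν) : ∃ C : ℝ, 0 < C ∧ ∀ (a : ℝ) (r : ℕ) (x : ℝ), 1 ≤ r →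
      partialGreen ν Set.univ (Set.Ico a (a + 1)) (r ^ 2) x ≤ ENNReal.ofReal (C * r) := by
  have hint : Integrable (fun x : ℝ => x) ν := hL2.integrable (by norm_num)
  set ψ : ℝ → ℝ := fun y => y ^ 2 / (8 + 4 * |y|) with hψ
  have hψ0 : ∀ y, 0 ≤ ψ y := fun y => by positivity
  have hψc : Continuous ψ := by
    refine Continuous.div (by fun_prop) (by fun_prop) fun y => ?_
    positivity
  have hψint : Integrable ψ ν := by
    refine hint.abs.mono hψc.aestronglyMeasurable (Eventually.of_forall fun y => ?_)
    rw [Real.norm_of_nonneg (hψ0 y), Real.norm_of_nonneg (abs_nonneg y)]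
    simp only [hψ]
    rw [div_le_iff₀ (by positivity), ← sq_abs]
    nlinarith [abs_nonneg y]
  have hδ : 0 < ∫ y, ψ y ∂ν := by
    rw [integral_pos_iff_support_of_nonneg hψ0 hψint]
    rw [integral_pos_iff_support_of_nonneg (fun y => sq_nonneg y) hL2.integrable_sq] at hv
    refine hv.trans_le (measure_mono fun y hy => ?_)
    simp only [Function.mem_support, hψ] at hy ⊢
    exact div_ne_zero hy (by positivity)
  set δ := ∫ y, ψ y ∂ν
  have hB : 0 < 1 + ∫ y, y ^ 2 ∂ν := by positivity
  refine ⟨(1 + ∫ y, y ^ 2 ∂ν) / δ, by positivity, fun a r x hr => ?_⟩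
  set I := Set.Ico a (a + 1) with hI
  -- A Lyapunov function: its mean never decreases along the walk, and each visit to `I` raises it
  -- by at least `δ`. As `Φ` is 1-Lipschitz, the total rise is at most the mean displacement at time
  -- `r ^ 2`, of order `r`.
  set Φ : ℝ → ℝ≥0∞ := fun x => ENNReal.ofReal √(1 + (x - a) ^ 2) with hΦ
  have hΦm : Measurable Φ := by fun_prop
  have hstep : ∀ x, ENNReal.ofReal δ * I.indicator 1 x + Φ x ≤ killedMean ν Set.univ Φ x := by
    intro x
    set b := x - a with hb
    have hKint : Integrable (fun y => √(1 + (b + y) ^ 2)) ν := by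
      refine (((integrable_const (√(1 + b ^ 2))).add hint.abs)).mono
        (by fun_prop) (Eventually.of_forall fun y => ?_)
      simp only [Pi.add_apply]
      rw [Real.norm_of_nonneg (by positivity), Real.norm_of_nonneg (by positivity)]
      exact sqrt_one_add_sq_add_le b y
    have h1 : killedMean ν Set.univ Φ x = ENNReal.ofReal (∫ y, √(1 + (b + y) ^ 2) ∂ν) := by
      rw [killedMean, Set.indicator_univ, ofReal_integral_eq_lintegral_ofReal hKint
        (Eventually.of_forall fun y => by positivity)]
      refine lintegral_congr fun y => ?_
      simp only [hΦ, hb]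
      ring_nf
    have h2 : √(1 + b ^ 2) + (if |b| ≤ 1 then δ else 0) ≤ ∫ y, √(1 + (b + y) ^ 2) ∂ν := by
      have h3 : ∫ y, (√(1 + b ^ 2) + b / √(1 + b ^ 2) * y + (if |b| ≤ 1 then ψ y else 0)) ∂ν =
          √(1 + b ^ 2) + (if |b| ≤ 1 then δ else 0) := by
        have hi : Integrable (fun y => √(1 + b ^ 2) + b / √(1 + b ^ 2) * y) ν :=
          (integrable_const _).add (hint.const_mul _)
        have hi' : ∫ y, (√(1 + b ^ 2) + b / √(1 + b ^ 2) * y) ∂ν = √(1 + b ^ 2) := by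
          rw [integral_add (integrable_const _) (hint.const_mul _), integral_const_mul, hmean]
          simp
        split_ifs
        · rw [integral_add hi hψint, hi']
        · simp only [add_zero]
          exact hi'
      rw [← h3]
      refine integral_mono ?_ hKint fun y => sqrt_one_add_sq_convex b y
      refine ((integrable_const _).add (hint.const_mul _)).add ?_
      split_ifs
      · exact hψint
      · exact integrable_zero _ _ _
    rw [h1]
    have hx1 : ENNReal.ofReal δ * I.indicator 1 x ≤
        ENNReal.ofReal (if |b| ≤ 1 then δ else 0) := by
      by_cases hx : x ∈ I
      · have hb1 : |b| ≤ 1 := abs_le.2 ⟨by linarith [hx.1], by linarith [hx.2]⟩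
        simp [hx, hb1]
      · simp [hx]
    have hite : 0 ≤ (if |b| ≤ 1 then δ else 0) := by split_ifs <;> positivity
    calc ENNReal.ofReal δ * I.indicator 1 x + Φ x
        ≤ ENNReal.ofReal (if |b| ≤ 1 then δ else 0) + ENNReal.ofReal √(1 + b ^ 2) := by
          gcongr
      _ = ENNReal.ofReal (√(1 + b ^ 2) + (if |b| ≤ 1 then δ else 0)) := by
          rw [← ENNReal.ofReal_add hite (by positivity), add_comm]
      _ ≤ _ := ENNReal.ofReal_le_ofReal h2
  have hiter : ∀ (n : ℕ) (x : ℝ), ENNReal.ofReal δ * partialGreen ν Set.univ I n x + Φ x ≤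
      (killedMean ν Set.univ)^[n] Φ x := by
    intro n
    induction n with
    | zero => intro x; simp [partialGreen]
    | succ n ih =>
      intro x
      have hgm : Measurable (partialGreen ν Set.univ I n) :=
        measurable_partialGreen MeasurableSet.univ measurableSet_Ico n
      rw [Function.iterate_succ_apply', partialGreen, Pi.add_apply, mul_add]
      calc ENNReal.ofReal δ * I.indicator 1 x +
            ENNReal.ofReal δ * killedMean ν Set.univ (partialGreen ν Set.univ I n) x + Φ x
          = ENNReal.ofReal δ * killedMean ν Set.univ (partialGreen ν Set.univ I n) x +
            (ENNReal.ofReal δ * I.indicator 1 x + Φ x) := by ring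
        _ ≤ ENNReal.ofReal δ * killedMean ν Set.univ (partialGreen ν Set.univ I n) x +
            killedMean ν Set.univ Φ x := by gcongr; exact hstep x
        _ = killedMean ν Set.univ
            ((fun x => ENNReal.ofReal δ * partialGreen ν Set.univ I n x) + Φ) x := by
          rw [killedMean_add (hgm.const_mul _), killedMean_const_mul _ hgm]
          rfl
        _ ≤ _ := killedMean_mono (fun x => ih x) x
  have h1 := hiter (r ^ 2) x
  rw [iterate_killedMean_univ hΦm] at h1
  have h2 : ∫⁻ z, Φ (x + ∑ i ∈ Finset.range (r ^ 2), z i) ∂(stepsLaw ν) ≤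
      ENNReal.ofReal ((1 + ∫ y, y ^ 2 ∂ν) * r) + Φ x := by
    calc ∫⁻ z, Φ (x + ∑ i ∈ Finset.range (r ^ 2), z i) ∂(stepsLaw ν)
        ≤ ∫⁻ z, (ENNReal.ofReal |∑ i ∈ Finset.range (r ^ 2), z i| + Φ x) ∂(stepsLaw ν) := by
          refine lintegral_mono fun z => ?_
          simp only [hΦ]
          rw [← ENNReal.ofReal_add (abs_nonneg _) (by positivity)]
          refine ENNReal.ofReal_le_ofReal ?_
          have := sqrt_one_add_sq_add_le (x - a) (∑ i ∈ Finset.range (r ^ 2), z i)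
          rw [show x + ∑ i ∈ Finset.range (r ^ 2), z i - a =
            x - a + ∑ i ∈ Finset.range (r ^ 2), z i by ring]
          linarith
      _ ≤ _ := by
          rw [lintegral_add_right _ measurable_const, lintegral_const, measure_univ, mul_one]
          gcongr
          exact lintegral_abs_sum_le hL2 hmean hr
  have h3 := (ENNReal.add_le_add_iff_right (by simp [hΦ])).1 (h1.trans h2)
  rw [mul_comm, ← ENNReal.le_div_iff_mul_le (by simp [hδ]) (by simp),
    ← ENNReal.ofReal_div_of_pos hδ] at h3
  refine h3.trans (le_of_eq ?_)
  rw [div_mul_eq_mul_div]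

/-- By the central limit theorem the sum divided by `n` is asymptotically Gaussian with positive
variance, and this Gaussian law charges `(-∞, -3)`. The constant `3` suits a walk started below `n +
1 ≤ 2 * n` and killed to the left of `-n`. -/
theorem exists_eventually_measure_sum_ge_le (hL2 : MemLp (fun x : ℝ => x) 2 ν)
    (hmean : ∫ x, x ∂ν = 0) (hv : 0 < ∫ y, y ^ 2 ∂ν) : ∃ q : ℝ≥0∞, q < 1 ∧ ∀ᶠ n : ℕ in atTop,
      stepsLaw ν {z | -(3 * n : ℝ) ≤ ∑ i ∈ Finset.range (n ^ 2), z i} ≤ q := by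
  have hmp : MeasurePreserving (fun z : ℕ → ℝ => z 0) (stepsLaw ν) ν :=
    ⟨measurable_pi_apply 0, map_eval_stepsLaw 0⟩
  have hX2 : MemLp (fun z : ℕ → ℝ => z 0) 2 (stepsLaw ν) := hL2.comp_measurePreserving hmp
  have hX0 : ∫ z, z 0 ∂(stepsLaw ν) = 0 := by
    rw [← hmean, integral_eval_stepsLaw measurable_id']
  have hXv : Var[fun z : ℕ → ℝ => z 0; stepsLaw ν] = ∫ y, y ^ 2 ∂ν := by
    rw [variance_of_integral_eq_zero hmp.aemeasurable hX0,
      integral_eval_stepsLaw (f := fun y => y ^ 2) (by fun_prop)]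
  set σ := Var[fun z : ℕ → ℝ => z 0; stepsLaw ν].toNNReal with hσ
  have hσ0 : σ ≠ 0 := by
    rw [hσ, hXv]
    simpa using hv
  have hclt := tendstoInDistribution_inv_sqrt_mul_sum_sub (P := stepsLaw ν)
    (X := fun (i : ℕ) (z : ℕ → ℝ) => z i) (Y := id) (P' := gaussianReal 0 σ)
    HasLaw.id hX2 iIndepFun_stepsLaw identDistrib_stepsLaw
  have hsq : Tendsto (fun n : ℕ => n ^ 2) atTop atTop := tendsto_pow_atTop (by norm_num)
  have hlim := ProbabilityMeasure.limsup_measure_closed_le_of_tendsto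
    (hclt.tendsto.comp hsq) (isClosed_Ici (a := (-3 : ℝ)))
  have hlt : gaussianReal 0 σ (Set.Ici (-3)) < 1 := by
    have hpos : 0 < gaussianReal 0 σ (Set.Iio (-3)) := by
      refine pos_iff_ne_zero.2 fun h0 => ?_
      have := gaussianReal_absolutelyContinuous' 0 hσ0 h0
      simp at this
    rw [← Set.compl_Iio, prob_compl_eq_one_sub measurableSet_Iio]
    exact ENNReal.sub_lt_self ENNReal.one_ne_top one_ne_zero hpos.ne'
  obtain ⟨q, hq1, hq2⟩ := exists_between hlt
  refine ⟨q, hq2, ?_⟩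
  have hev := eventually_lt_of_limsup_lt (hlim.trans_lt (by simpa using hq1))
  filter_upwards [hev, eventually_ge_atTop 1] with n hn hn1
  have hn' : (stepsLaw ν).map (fun z : ℕ → ℝ => (√((n ^ 2 : ℕ) : ℝ))⁻¹ *
      (∑ k ∈ Finset.range (n ^ 2), z k - ((n ^ 2 : ℕ) : ℝ) * ∫ z, z 0 ∂(stepsLaw ν)))
      (Set.Ici (-3)) < q := hn
  have hn0 : (0 : ℝ) < n := by exact_mod_cast hn1
  rw [Measure.map_apply (by fun_prop) measurableSet_Ici, hX0] at hn'
  refine le_trans (le_of_eq ?_) hn'.le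
  congr 1
  ext z
  simp only [Set.mem_ofPred_eq, Set.mem_preimage, Set.mem_Ici]
  push_cast
  rw [Real.sqrt_sq hn0.le, mul_zero, sub_zero, ← div_eq_inv_mul, le_div_iff₀ hn0]
  ring_nf

/-- The Green function at `[n, n + 1)` of a centered random walk with finite variance which is
killed to the left of `-n` is `O(n)`. -/
theorem exists_eventually_partialGreen_le (hL2 : MemLp (fun x : ℝ => x) 2 ν)
    (hmean : ∫ x, x ∂ν = 0) (hv : 0 < ∫ y, y ^ 2 ∂ν) : ∃ C : ℝ, 0 < C ∧ ∀ᶠ n : ℕ in atTop,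
      ∀ (M : ℕ) (x : ℝ), partialGreen ν (Set.Ici (-n : ℝ)) (Set.Ico (n : ℝ) (n + 1)) M x ≤
        ENNReal.ofReal (C * n) := by
  obtain ⟨C, hC, hgreen⟩ := exists_partialGreen_sq_le hL2 hmean hv
  obtain ⟨q, hq, hev⟩ := exists_eventually_measure_sum_ge_le hL2 hmean hv
  have hq' : 1 - q ≠ ∞ := ENNReal.sub_ne_top ENNReal.one_ne_top
  have hq0 : 0 < (1 - q).toReal := ENNReal.toReal_pos (tsub_pos_of_lt hq).ne' hq'
  refine ⟨(C + 1) / (1 - q).toReal, by positivity, ?_⟩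
  filter_upwards [hev, eventually_ge_atTop 1] with n hn hn1 M x
  have hn0 : (1 : ℝ) ≤ n := by exact_mod_cast hn1
  refine (partialGreen_le (ν := ν) measurableSet_Ici measurableSet_Ico (u := fun _ => 1)
    measurable_const (fun _ => le_rfl) (fun _ _ => le_rfl) ?_ (N := n ^ 2 + 1)
    (b := ENNReal.ofReal ((C + 1) * n)) hq ?_ ?_ M x).trans (le_of_eq ?_)
  · refine (killedMean_le_univ _).trans fun x => ?_
    simp [killedMean]
  · intro x _
    rw [partialGreen, Pi.add_apply]
    calc _ ≤ (1 : ℝ≥0∞) + ENNReal.ofReal (C * n) := by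
          refine add_le_add (Set.indicator_le_self' (fun _ _ => zero_le) x) ?_
          refine (Set.indicator_le_self _ _ _).trans ((lintegral_mono fun y =>
            (partialGreen_le_univ _ _).trans (hgreen n n (x + y) hn1)).trans ?_)
          simp
      _ ≤ ENNReal.ofReal ((C + 1) * n) := by
          rw [← ENNReal.ofReal_one, ← ENNReal.ofReal_add zero_le_one (by positivity)]
          exact ENNReal.ofReal_le_ofReal (by linarith)
  · intro x hx
    -- Killing is tested before each step, so the innermost of the `n ^ 2 + 1` operators tests the
    -- position at time `n ^ 2`. The other tests are dropped.
    rw [Function.iterate_succ_apply]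
    have h1 : killedMean ν (Set.Ici (-n : ℝ)) (fun _ => 1) = (Set.Ici (-n : ℝ)).indicator 1 := by
      ext x
      simp [killedMean, Set.indicator]
    rw [h1]
    refine (iterate_killedMean_le_univ _ _ x).trans ?_
    have hm : Measurable fun z : ℕ → ℝ => x + ∑ i ∈ Finset.range (n ^ 2), z i := by fun_prop
    rw [iterate_killedMean_univ (measurable_one.indicator measurableSet_Ici)]
    have h2 : ∫⁻ z, (Set.Ici (-n : ℝ)).indicator 1 (x + ∑ i ∈ Finset.range (n ^ 2), z i)
        ∂(stepsLaw ν) = stepsLaw ν ((fun z : ℕ → ℝ => x + ∑ i ∈ Finset.range (n ^ 2), z i) ⁻¹'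
        Set.Ici (-n : ℝ)) := by
      rw [← lintegral_indicator_one (hm measurableSet_Ici)]
      rfl
    rw [h2]
    refine (measure_mono fun z hz => ?_).trans hn
    simp only [Set.mem_preimage, Set.mem_Ici] at hz
    simp only [Set.mem_ofPred_eq]
    linarith [hx.2]
  · rw [div_mul_eq_mul_div, ENNReal.ofReal_div_of_pos hq0, ENNReal.ofReal_toReal hq']

end walk

/-! ### The hypotheses in terms of the tilted law, and the conclusion. -/

section tilt

variable {μ : Measure ℝ} {t : ℝ}

theorem lintegral_expTilt {φ : ℝ → ℝ≥0∞} (hφ : Measurable φ) :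
    ∫⁻ x, φ x ∂(expTilt μ t) = ∫⁻ x, ENNReal.ofReal (Real.exp (-t * x)) * φ x ∂μ :=
  lintegral_withDensity_eq_lintegral_mul _ (by fun_prop) hφ

theorem isProbabilityMeasure_expTilt (h : logLaplace μ t = 0) :
    IsProbabilityMeasure (expTilt μ t) := by
  refine ⟨?_⟩
  rw [← lintegral_one, lintegral_expTilt measurable_const]
  simp only [mul_one]
  rw [logLaplace, ← ENNReal.log_one] at h
  exact ENNReal.log_injective h

theorem lintegral_ofReal_expTilt :
    ∫⁻ x, ENNReal.ofReal x ∂(expTilt μ t) = posMoment μ t := by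
  rw [lintegral_expTilt (by fun_prop), posMoment, ← lintegral_indicator measurableSet_Ioi]
  refine lintegral_congr fun x => ?_
  by_cases hx : 0 < x
  · rw [Set.indicator_of_mem (by exact hx), mul_comm, ← ENNReal.ofReal_mul hx.le]
  · rw [Set.indicator_of_notMem (by exact hx), ENNReal.ofReal_of_nonpos (not_lt.1 hx), mul_zero]

theorem lintegral_ofReal_neg_expTilt :
    ∫⁻ x, ENNReal.ofReal (-x) ∂(expTilt μ t) = negMoment μ t := by
  rw [lintegral_expTilt (by fun_prop), negMoment, ← lintegral_indicator measurableSet_Iio]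
  refine lintegral_congr fun x => ?_
  by_cases hx : x < 0
  · rw [Set.indicator_of_mem (by exact hx), mul_comm, ← ENNReal.ofReal_mul (by linarith),
      abs_of_neg hx]
  · have hx' : -x ≤ 0 := by linarith
    rw [Set.indicator_of_notMem (by exact hx), ENNReal.ofReal_of_nonpos hx', mul_zero]

theorem lintegral_sq_expTilt : ∫⁻ x, ENNReal.ofReal (x ^ 2) ∂(expTilt μ t) =
    ∫⁻ x, ENNReal.ofReal (x ^ 2 * Real.exp (-t * x)) ∂μ := by
  rw [lintegral_expTilt (by fun_prop)]
  refine lintegral_congr fun x => ?_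
  rw [mul_comm, ← ENNReal.ofReal_mul (sq_nonneg x)]

/-- Well-definedness rules out that both parts are infinite, and equal finite parts would cancel. -/
theorem posMoment_ne_negMoment (h : MomentWellDefined μ t) (h0 : moment1 μ t ≠ 0) :
    posMoment μ t ≠ negMoment μ t := by
  intro heq
  have htop : negMoment μ t ≠ ∞ := by
    rcases h with h | h
    · rwa [heq] at h
    · exact h
  apply h0
  rw [moment1, heq]
  exact EReal.sub_self (by simpa using htop) (by simp)

theorem posMoment_eq_negMoment (h : MomentWellDefined μ t) (h0 : moment1 μ t = 0) :
    posMoment μ t = negMoment μ t := by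
  rw [moment1] at h0
  unfold MomentWellDefined at h
  generalize posMoment μ t = p at *
  generalize negMoment μ t = n at *
  induction p with
  | top =>
    induction n with
    | top => rfl
    | coe n => simp at h0
  | coe p =>
    induction n with
    | top => simp at h0
    | coe n =>
      have h1 : ((p : ℝ) : EReal) - ((n : ℝ) : EReal) = 0 := h0
      norm_cast at h1
      exact_mod_cast sub_eq_zero.1 h1

end tilt

/-- Conditioning preserves null sets, and the single event of the polynomial bound serves all `κ` at
once. -/
theorem ae_Pstar_tendsto {Ω : Type*} [MeasurableSpace Ω] {P : Measure Ω} (B : BranchingRandomWalk P)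
    {j : ℕ} (h : ∃ A : ℕ, ∀ᵐ ω ∂P, ∀ᶠ n : ℕ in atTop,
      B.supLocalTime ω n ≤ (A : ℝ≥0∞) * (n : ℝ≥0∞) ^ j) :
    ∀ᵐ ω ∂B.Pstar, ∀ κ : ℝ, j < κ →
      Tendsto (fun n : ℕ => B.supLocalTime ω n / (n : ℝ≥0∞) ^ κ) atTop (𝓝 0) := by
  obtain ⟨A, hA⟩ := h
  filter_upwards [cond_absolutelyContinuous.ae_le hA] with ω hω κ hκ
  exact BranchingRandomWalk.tendsto_supLocalTime_div hω hκ

theorem theorem1p4 {Ω : Type*} [MeasurableSpace Ω] (P : Measure Ω) [IsProbabilityMeasure P]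
    (B : BranchingRandomWalk P) (hsupercritical : 1 < B.mu Set.univ) :
    (H1 B.mu → ∀ᵐ ω ∂B.Pstar, ∀ κ : ℝ, 1 < κ →
      Tendsto (fun n : ℕ => B.supLocalTime ω n / (n : ℝ≥0∞) ^ κ) atTop (𝓝 0)) ∧
    (H2 B.mu → ∀ᵐ ω ∂B.Pstar, ∀ κ : ℝ, 2 < κ →
      Tendsto (fun n : ℕ => B.supLocalTime ω n / (n : ℝ≥0∞) ^ κ) atTop (𝓝 0)) := by
  constructor
  · rintro ⟨t, ⟨⟨ht, hφ⟩, -⟩, hwd, hne⟩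
    have := isProbabilityMeasure_expTilt hφ
    obtain ⟨N, hN⟩ := exists_partialGreen_le_of_drift (ν := expTilt B.mu t) (by
      rw [lintegral_ofReal_expTilt, lintegral_ofReal_neg_expTilt]
      exact posMoment_ne_negMoment hwd hne)
    -- Transience bounds even the unkilled Green function; `N + 1` replaces `N` only to be positive.
    have hA := B.ae_eventually_supLocalTime_le ht 0 (C := N + 1) (by positivity)
      (Eventually.of_forall fun n => exists_green measurableSet_Ici measurableSet_Ico fun M x =>
        (partialGreen_le_univ M x).trans ((hN n M x).trans (by
          rw [pow_zero, mul_one, ← ENNReal.ofReal_natCast]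
          exact ENNReal.ofReal_le_ofReal (by linarith))))
    simpa using ae_Pstar_tendsto B hA
  · rintro ⟨t, ht, hφ, -, hwd, h0, hv0, hv⟩
    have := isProbabilityMeasure_expTilt hφ
    rw [← lintegral_sq_expTilt] at hv hv0
    have hL2 : MemLp (fun x : ℝ => x) 2 (expTilt B.mu t) := by
      rw [memLp_two_iff_integrable_sq (by fun_prop)]
      refine ⟨by fun_prop, ?_⟩
      rw [hasFiniteIntegral_iff_ofReal (Eventually.of_forall fun x => sq_nonneg x)]
      exact hv
    have hmean : ∫ x, x ∂(expTilt B.mu t) = 0 := by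
      rw [integral_eq_lintegral_pos_part_sub_lintegral_neg_part (hL2.integrable (by norm_num)),
        lintegral_ofReal_expTilt, lintegral_ofReal_neg_expTilt, posMoment_eq_negMoment hwd h0,
        sub_self]
    have hvar : 0 < ∫ x, x ^ 2 ∂(expTilt B.mu t) := by
      rw [integral_eq_lintegral_of_nonneg_ae (Eventually.of_forall fun x => sq_nonneg x)
        (by fun_prop)]
      exact ENNReal.toReal_pos hv0.ne' hv.ne
    obtain ⟨C, hC, hgreen⟩ := exists_eventually_partialGreen_le hL2 hmean hvar
    have hA := B.ae_eventually_supLocalTime_le ht 1 hC (by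
      filter_upwards [hgreen] with n hn
      rw [pow_one]
      exact exists_green measurableSet_Ici measurableSet_Ico hn)
    simpa using ae_Pstar_tendsto B hA
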